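/- **Setting.** Let $\mathcal X$ be a measurable space, $d\in\mathbb N$, and let $\mathcal C$ be a nonempty class of functions $\Pi^{(c)}:\mathcal X\to\mathbb C^{d\times d}$ all of whose values are orthogonal projectors. For $x=(x_1,\dots,x_n)\in\mathcal X^n$ put $\|f\|_{1,\infty,x}=\frac1n\sum_{i=1}^n\|f(x_i)\|_\infty$ (operator norm), and let $\Gamma_{1,\infty}(n,r,\mathcal C)$ be the maximum over $x\in\mathcal X^n$ of the least cardinality of a subset of $\mathcal C$ that is an $r$-cover of $\mathcal C$ for this seminorm. Given data $x$ and density matrices $\rho_i=\rho(x_i)$, the tilted value of $c$ is $$\mu_c(\gamma)=\frac1\gamma\log\Big(\frac1n\sum_{i=1}^n e^{\gamma\,\mathrm{Tr}[\rho_i\Pi^{(c)}(x_i)]}\Big),$$ so that $1-\mu_c(\gamma)$ is the tilted empirical risk of $c$. Write $\mathrm{opt}_{c\in\mathcal C}\,\mu_c(\gamma)$ for either $\sup_{c\in\mathcal C}\mu_c(\gamma)$ or $\inf_{c\in\mathcal C}\mu_c(\gamma)$; the theorem holds for each of the two choices. **Learner.** A learner receives $n$ classical–quantum samples $(x_i,\rho(x_i))$,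 with $x_i\sim D$ i.i.d. for an unknown probability distribution $D$ and with $\rho$ an unknown classical–quantum channel $x\mapsto\rho(x)$. From $x$ alone it forms an $\varepsilon/2$-net of $\mathcal C$ for $\|\cdot\|_{1,\infty,x}$, contained in $\mathcal C$ and of size at most $\Gamma_{1,\infty}(n,\varepsilon/2,\mathcal C)$. It then performs on $\rho(x_1)\otimes\dots\otimes\rho(x_n)$ a quantum measurement that is determined by the projectors $\Pi^{(c)}(x_i)$ with $c$ in the net, and outputs an element $c^*$ of the net and an estimate $\hat\mu_{c^*}(\gamma)\in\mathbb R$. Its error probability, over the data and the measurement, is $$p_{\rm err}=\Pr\Big(\big|\hat\mu_{c^*}(\gamma)-\mathop{\mathrm{opt}}_{c\in\mathcal C}\mu_c(\gamma)\big|\ge3\varepsilon\ \cup\ \big|\hat\mu_{c^*}(\gamma)-\mu_{c^*}(\gamma)\big|\ge2\varepsilon\Big).$$ **Theorem.** There are universal constants $C_1,C_2,C_3,K>0$ such that the following holds for all $\mathcal X$, $d$ and $\mathcal C$ as above with $\Gamma_{1,\infty}(n,r,\mathcal C)<\infty$ for all $n$ and $r>0$ and $$\lim_{n\to\infty}\frac{\log^2\Gamma_{1,\infty}(n,r,\mathcal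 C)}{n}=0\quad\text{for all } r>0.$$ Let $\varepsilon>0$, $0<\delta<1$ and $0<|\gamma|<\varepsilon$, and let $T,k\ge1$ be integers with $T\ge K\log\frac2\varepsilon$ and $k\ge K\log\frac2\delta\log\frac2\varepsilon$. (a) For every integer $l\ge1$ with $\big(\log\Gamma_{1,\infty}(6Tkl,\varepsilon/2,\mathcal C)+C_2\big)^2\le C_1l\varepsilon^2$ there is a learner using $n=6Tkl$ samples such that, for every $D$ and every channel $\rho$, $$p_{\rm err}\le\frac\delta2+C_3\,Tk\,\Gamma_{1,\infty}(6Tkl,\varepsilon/2,\mathcal C)\,e^{-\frac{l|\gamma|\varepsilon^2}{12(e^{|\gamma|}-1)}}+8\,\Gamma_{1,\infty}(12Tkl,\varepsilon/128,\mathcal C)\,e^{-\frac{6Tkl\,\varepsilon^2}{512|e^\gamma-1|}}.$$ (b) For all sufficiently large $l$ the condition in (a) holds and the right-hand side in (a) is at most $\delta$. Hence $p_{\rm err}$ can be made arbitrarily small. -/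

import Mathlib

namespace QTERM

open scoped ComplexOrder

noncomputable section

/-- Operators on the qudit space `ℂ^d`, as complex matrices. -/
abbrev Op (d : ℕ) : Type := Matrix (Fin d) (Fin d) ℂ

/-- Operators on the `n`-fold tensor power of `ℂ^d`, whose standard basis is indexed by
`Fin n → Fin d`. -/
abbrev RegOp (d n : ℕ) : Type := Matrix (Fin n → Fin d) (Fin n → Fin d) ℂ

/-- A density matrix: positive semidefinite with trace one. -/
def IsDensity {d : ℕ} (ρ : Op d) : Prop := ρ.PosSemidef ∧ ρ.trace = 1

/-- The product operator `ρ₁ ⊗ ⋯ ⊗ ρₙ`. -/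
def productState {d n : ℕ} (ρ : Fin n → Op d) : RegOp d n :=
  Matrix.of fun a b => ∏ i, ρ i (a i) (b i)

/-- The Schatten-`∞` norm, i.e. the operator norm with respect to the Euclidean norm of `ℂ^d`. -/
def opNorm {d : ℕ} (A : Op d) : ℝ := ‖Matrix.toEuclideanCLM (n := Fin d) (𝕜 := ℂ) A‖

/-- The seminorm `‖·‖_{1,∞,x}` on operator-valued functions, for a data set `x = (x₁, …, xₙ)`:
the average over the data of the operator norm. -/
def seminormOneInf {X : Type*} {d n : ℕ} (x : Fin n → X) (f : X → Op d) : ℝ :=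
  (1 / (n : ℝ)) * ∑ i, opNorm (f (x i))

/-- `N` is an internal `r`-cover of the class `C` with respect to `‖·‖_{1,∞,x}`. -/
def IsInternalCover {X : Type*} {d n : ℕ} (x : Fin n → X) (r : ℝ)
    (C N : Set (X → Op d)) : Prop :=
  N ⊆ C ∧ ∀ f ∈ C, ∃ g ∈ N, seminormOneInf x (f - g) ≤ r

/-- The operator covering number `Γ_{1,∞}(n, r, C)`: the largest value, over data sets of size `n`,
of the smallest cardinality of an internal `r`-cover (`⊤` if these are not bounded). -/
def coveringNumber {X : Type*} {d : ℕ} (n : ℕ) (r : ℝ) (C : Set (X → Op d)) : ℕ∞ :=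
  ⨆ x : Fin n → X, ⨅ N : {N : Set (X → Op d) // IsInternalCover x r C N}, (N : Set (X → Op d)).encard

/-- The covering numbers of `C` are finite and `log² Γ_{1,∞}(n, r, C) / n → 0`, at every scale. -/
def SlowCovering {X : Type*} {d : ℕ} (C : Set (X → Op d)) : Prop :=
  ∀ r : ℝ, 0 < r → (∀ n : ℕ, coveringNumber n r C ≠ ⊤) ∧
    Filter.Tendsto (fun n : ℕ => Real.log ((coveringNumber n r C).toNat : ℝ) ^ 2 / (n : ℝ))
      Filter.atTop (nhds 0)

/-- The tilted value `μ(γ) = γ⁻¹ log (n⁻¹ ∑ᵢ exp (γ Tr[ρᵢ Πᵢ]))` of a list of projectors on a list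
of states; `1 - μ(γ)` is the tilted empirical risk. -/
def tiltedValue {d n : ℕ} (γ : ℝ) (ρ P : Fin n → Op d) : ℝ :=
  (1 / γ) * Real.log ((1 / (n : ℝ)) * ∑ i, Real.exp (γ * ((ρ i * P i).trace).re))

/-- A quantum measurement with finitely many outcomes in `Ω`, given by its positive
operator-valued measure. Every (adaptive, randomized) measurement procedure on the register with
finitely many outcomes is of this form. -/
structure FinitePOVM (d n : ℕ) (Ω : Type*) where
  outcomes : Finset Ω
  effect : Ω → RegOp d n
  posSemidef : ∀ ω ∈ outcomes, (effect ω).PosSemidef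
  sum_effect : ∑ ω ∈ outcomes, effect ω = 1

open Classical in
/-- The probability (Born rule) that the outcome of the measurement `M` on the state `ρ`
lies in `E`. -/
def FinitePOVM.prob {d n : ℕ} {Ω : Type*} (M : FinitePOVM d n Ω) (ρ : RegOp d n) (E : Set Ω) : ℝ :=
  ∑ ω ∈ M.outcomes with ω ∈ E, ((M.effect ω * ρ).trace).re

/-- A learner for the class `C` with `n` classical-quantum samples.
From the classical data `x` alone it forms a finite internal `r`-cover
of `C` of size at most `Γ_{1,∞}(n, r, C)`; then it performs on the `n` quantum states a measurement
that is chosen from the projectors `Π_c(xᵢ)` with `c` in the cover, and whose outcome is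
(the index of) an element of the cover together with a real estimate. -/
structure Learner {X : Type*} {d : ℕ} (C : Set (X → Op d)) (n : ℕ) (r : ℝ) where
  size : (Fin n → X) → ℕ
  size_pos : ∀ x, 0 < size x
  net : (x : Fin n → X) → Fin (size x) → (X → Op d)
  net_cover : ∀ x, IsInternalCover x r C (Set.range (net x))
  size_le : ∀ x, (size x : ℕ∞) ≤ coveringNumber n r C
  select : (m : ℕ) → 0 < m → (Fin m → Fin n → Op d) → FinitePOVM d n (Fin m × ℝ)

variable {X : Type*} {d n : ℕ} {C : Set (X → Op d)} {r : ℝ}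

/-- The measurement that the learner performs on the quantum states, given the classical data. -/
def Learner.measurement (A : Learner C n r) (x : Fin n → X) :
    FinitePOVM d n (Fin (A.size x) × ℝ) :=
  A.select (A.size x) (A.size_pos x) fun j i => A.net x j (x i)

/-- The tilted value of the concept `c` on the data `x`, with states `ρ (xᵢ)`. -/
def conceptValue (γ : ℝ) (ρ : X → Op d) (x : Fin n → X) (c : X → Op d) : ℝ :=
  tiltedValue γ (fun i => ρ (x i)) fun i => c (x i)

/-- The error event for the output `(c*, v)`: the estimate `v` is off by `3ε` or more from the
optimal tilted value over `C` (`opt` is the supremum or the infimum), or by `2ε` or more from the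
tilted value of `c*`. -/
def Learner.errorEvent (A : Learner C n r) (opt : Set ℝ → ℝ) (γ ε : ℝ) (ρ : X → Op d)
    (x : Fin n → X) : Set (Fin (A.size x) × ℝ) :=
  {ω | 3 * ε ≤ |ω.2 - opt (conceptValue γ ρ x '' C)| ∨
       2 * ε ≤ |ω.2 - conceptValue γ ρ x (A.net x ω.1)|}

/-- The upper integral of a nonnegative function: it agrees with the Lebesgue integral when `f` is
measurable, and is an upper bound for it in general. -/
def upperIntegral {α : Type*} [MeasurableSpace α] (μ : MeasureTheory.Measure α)
    (f : α → ENNReal) : ENNReal :=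
  ⨅ (g : α → ENNReal) (_ : Measurable g) (_ : ∀ a, f a ≤ g a), ∫⁻ a, g a ∂μ

/-- The error probability `p_err`, when `x₁, …, xₙ` are independent with distribution `D` and the
channel `ρ` produces the states `ρ (xᵢ)`: the expectation over the data of the probability of
the error event under the learner's measurement. -/
def Learner.errorProb [MeasurableSpace X] (A : Learner C n r) (opt : Set ℝ → ℝ) (γ ε : ℝ)
    (D : MeasureTheory.Measure X) [MeasureTheory.SigmaFinite D] (ρ : X → Op d) : ENNReal :=
  upperIntegral (MeasureTheory.Measure.pi fun _ : Fin n => D) fun x =>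
    ENNReal.ofReal ((A.measurement x).prob (productState fun i => ρ (x i))
      (A.errorEvent opt γ ε ρ x))

/-- The condition `(log Γ_{1,∞}(6Tkl, ε/2, C) + C₂)² ≤ C₁ l ε²` on the block length `l`. -/
def BlockCondition (C₁ C₂ ε : ℝ) (C : Set (X → Op d)) (T k l : ℕ) : Prop :=
  (Real.log ((coveringNumber (6 * T * k * l) (ε / 2) C).toNat : ℝ) + C₂) ^ 2
    ≤ C₁ * (l : ℝ) * ε ^ 2

/-- The explicit bound on the error probability. -/
def errorBound (C₃ ε δ γ : ℝ) (C : Set (X → Op d)) (T k l : ℕ) : ℝ :=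
  δ / 2
  + C₃ * (T : ℝ) * (k : ℝ) * ((coveringNumber (6 * T * k * l) (ε / 2) C).toNat : ℝ)
      * Real.exp (-((l : ℝ) * |γ| * ε ^ 2 / (12 * (Real.exp |γ| - 1))))
  + 8 * ((coveringNumber (12 * T * k * l) (ε / 128) C).toNat : ℝ)
      * Real.exp (-(6 * (T : ℝ) * (k : ℝ) * (l : ℝ) * ε ^ 2 / (512 * |Real.exp γ - 1|)))

end

end QTERM

open scoped ComplexOrder

namespace QTERM

/-! ### Exponential moments of bounded random variables on finite spaces -/

/-! By Hoeffding's lemma the tilted value is within |γ|/8 < ε/8 of the plain empirical mean of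
Tr[ρᵢΠᵢ], and passing from the class to the net costs ε/2. So it suffices to find a net element of
nearly optimal mean value and to estimate that value. The error is bounded for every fixed data set,
which makes the average over `D` harmless. Infima become suprema on replacing Π by 1 - Π.

The n = 2Nl registers, N = 3Tk, form l groups of 2N. An independent uniform cyclic shift of each
group deals them into N pairs of blocks of length l, and with high probability every block is
representative for every net element (`shift_deviation`). In each pair one block is searched for a
good concept and the fresh other block is measured to estimate it; the pair with the largest
estimate is reported (`exists_measurement`). One successful search suffices, so the error is (3/4)^N
plus union bounds with exponent lε²/8.

The core is `exists_search_measurement`: one block of length of order (log m)²/ε² serves to test all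
m concepts with constant success probability. Thresholds descend from 1 in steps of ε/4, and at each
threshold every concept is tested until one is accepted. The tests are soft: the odds of acceptance
are exp(u(count - θl)) with u of order 1/√l. Such odds have small relative variance, so rejection
moves the state by at most κp, where p = x/(1+x) for mean odds x (`logistic_test_gentle`). Rejection
also damps the amplitude by √(1-p) ≤ 1 - p/2, which pays for this disturbance: the total never
exceeds 2κ, however many tests are made (`seqEffect_trace_le`). False acceptances of bad concepts
sum geometrically to a small constant under the block condition, and the best concept has p ≥ 1/2 at
the first threshold below its value.

For (b), log²Γ = o(n) makes Γ subexponential, so both exponential terms vanish. -/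

open MeasureTheory ProbabilityTheory in
/-- Hoeffding's lemma for a Bernoulli variable. -/
lemma bernoulli_mgf_le {p : ℝ} (h0 : 0 ≤ p) (h1 : p ≤ 1) (u : ℝ) :
    1 + p * (Real.exp u - 1) ≤ Real.exp (p * u + u ^ 2 / 8) := by
  set μ : Measure ℝ := ENNReal.ofReal p • Measure.dirac 1 + ENNReal.ofReal (1 - p) • Measure.dirac 0
    with hμ
  have hprob : IsProbabilityMeasure μ := by
    constructor
    simp only [hμ, Measure.coe_add, Pi.add_apply, Measure.smul_apply, measure_univ, smul_eq_mul,
      mul_one]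
    rw [← ENNReal.ofReal_add h0 (by linarith)]
    simp
  have hint : ∀ f : ℝ → ℝ, ∫ y, f y ∂μ = p * f 1 + (1 - p) * f 0 := by
    intro f
    rw [hμ, integral_add_measure, integral_smul_measure, integral_smul_measure, integral_dirac,
      integral_dirac, ENNReal.toReal_ofReal h0, ENNReal.toReal_ofReal (by linarith)]
    · simp
    · exact (integrable_dirac (by simp)).smul_measure ENNReal.ofReal_ne_top
    · exact (integrable_dirac (by simp)).smul_measure ENNReal.ofReal_ne_top
  have hae : ∀ᵐ y ∂μ, id y ∈ Set.Icc (0 : ℝ) 1 := by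
    rw [hμ, ae_add_measure_iff]
    constructor
    · refine Measure.ae_smul_measure ?_ _
      rw [ae_dirac_iff (by exact measurableSet_Icc)]
      simp
    · refine Measure.ae_smul_measure ?_ _
      rw [ae_dirac_iff (by exact measurableSet_Icc)]
      simp
  -- Hoeffding's lemma on [0,1] for the two-point law `μ`; its mean `p` is subtracted here and
  -- restored in `e2`.
  have h := (hasSubgaussianMGF_of_mem_Icc (μ := μ) (X := id) aemeasurable_id hae).mgf_le u
  rw [mgf, hint, hint] at h
  have e1 : (((‖(1 : ℝ) - 0‖₊ / 2) ^ 2 : NNReal) : ℝ) * u ^ 2 / 2 = u ^ 2 / 8 := by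
    simp; ring
  rw [e1] at h
  have e2 : 1 + p * (Real.exp u - 1) = Real.exp (p * u) *
      (p * Real.exp (u * (1 - p)) + (1 - p) * Real.exp (u * (0 - p))) := by
    rw [mul_add, mul_left_comm, ← Real.exp_add, mul_left_comm, ← Real.exp_add]
    ring_nf
    simp
    ring
  rw [e2, Real.exp_add]
  refine mul_le_mul_of_nonneg_left ?_ (Real.exp_pos _).le
  simpa using h

/-- The chord of a convex function: among variables in [0,1] with a given mean, the Bernoulli one
has the largest exponential moment. -/
lemma exp_mul_le_of_mem_Icc {y : ℝ} (h0 : 0 ≤ y) (h1 : y ≤ 1) (u : ℝ) :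
    Real.exp (u * y) ≤ 1 + y * (Real.exp u - 1) := by
  have := convexOn_exp.2 (Set.mem_univ 0) (Set.mem_univ u) (sub_nonneg.2 h1) h0 (by ring)
  simp only [smul_eq_mul, mul_zero, zero_add, Real.exp_zero, mul_one] at this
  rw [mul_comm u y]
  linarith

section Finite

variable {ι α : Type*} [Fintype ι] [Fintype α]

/-- Hoeffding's lemma on a finite probability space. -/
lemma sum_mul_exp_le {q Y : α → ℝ} (hq : ∀ a, 0 ≤ q a) (hq1 : ∑ a, q a = 1)
    (hY0 : ∀ a, 0 ≤ Y a) (hY1 : ∀ a, Y a ≤ 1) (u : ℝ) :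
    ∑ a, q a * Real.exp (u * Y a) ≤ Real.exp ((∑ a, q a * Y a) * u + u ^ 2 / 8) := by
  have h0 : 0 ≤ ∑ a, q a * Y a := Finset.sum_nonneg fun a _ => mul_nonneg (hq a) (hY0 a)
  have h1 : ∑ a, q a * Y a ≤ 1 := by
    rw [← hq1]
    exact Finset.sum_le_sum fun a _ => mul_le_of_le_one_right (hq a) (hY1 a)
  refine le_trans ?_ (bernoulli_mgf_le h0 h1 u)
  calc ∑ a, q a * Real.exp (u * Y a)
      ≤ ∑ a, q a * (1 + Y a * (Real.exp u - 1)) :=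
        Finset.sum_le_sum fun a _ => mul_le_mul_of_nonneg_left
          (exp_mul_le_of_mem_Icc (hY0 a) (hY1 a) u) (hq a)
    _ = 1 + (∑ a, q a * Y a) * (Real.exp u - 1) := by
        rw [← hq1, Finset.sum_mul, ← Finset.sum_add_distrib, hq1]
        exact Finset.sum_congr rfl fun a _ => by ring

lemma sum_pi_mul_prod [DecidableEq ι] (q g : ι → α → ℝ) :
    ∑ s : ι → α, (∏ i, q i (s i)) * ∏ i, g i (s i) = ∏ i, ∑ a, q i a * g i a := by
  rw [Fintype.prod_sum]
  exact Finset.sum_congr rfl fun s _ => by rw [Finset.prod_mul_distrib]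

lemma sum_pi_weight [DecidableEq ι] {q : ι → α → ℝ} (hq1 : ∀ i, ∑ a, q i a = 1) :
    ∑ s : ι → α, ∏ i, q i (s i) = 1 := by
  rw [← Fintype.prod_sum]
  simp [hq1]

open Classical in
/-- Hoeffding's inequality for independent variables on finite spaces, upper tail. -/
lemma hoeffding_upper [DecidableEq ι] {q Y : ι → α → ℝ} (hq : ∀ i a, 0 ≤ q i a)
    (hq1 : ∀ i, ∑ a, q i a = 1) (hY0 : ∀ i a, 0 ≤ Y i a) (hY1 : ∀ i a, Y i a ≤ 1)
    {t : ℝ} (ht : 0 ≤ t) :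
    ∑ s : ι → α, (∏ i, q i (s i)) *
        (if (Fintype.card ι : ℝ) * t ≤ ∑ i, (Y i (s i) - ∑ a, q i a * Y i a) then 1 else 0)
      ≤ Real.exp (-(2 * (Fintype.card ι : ℝ) * t ^ 2)) := by
  set N := (Fintype.card ι : ℝ)
  -- The parameter 4t minimises u²/8 - ut over u.
  calc _ ≤ ∑ s : ι → α, (∏ i, q i (s i)) * (Real.exp (-(4 * t * (N * t))) *
          ∏ i, Real.exp (4 * t * (Y i (s i) - ∑ a, q i a * Y i a))) := by
        refine Finset.sum_le_sum fun s _ => mul_le_mul_of_nonneg_left ?_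
          (Finset.prod_nonneg fun i _ => hq i _)
        rw [← Real.exp_sum, ← Finset.mul_sum, ← Real.exp_add]
        split_ifs with h
        · rw [← Real.exp_zero]
          refine Real.exp_le_exp.2 ?_
          have := mul_le_mul_of_nonneg_left h (show 0 ≤ 4 * t by linarith)
          linarith
        · exact (Real.exp_pos _).le
    _ = Real.exp (-(4 * t * (N * t))) *
          ∏ i, ∑ a, q i a * Real.exp (4 * t * (Y i a - ∑ a, q i a * Y i a)) := by
        rw [← sum_pi_mul_prod q fun i a => Real.exp (4 * t * (Y i a - ∑ a, q i a * Y i a)),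
          Finset.mul_sum]
        exact Finset.sum_congr rfl fun s _ => by ring
    _ ≤ Real.exp (-(4 * t * (N * t))) * ∏ _i : ι, Real.exp ((4 * t) ^ 2 / 8) := by
        refine mul_le_mul_of_nonneg_left ?_ (Real.exp_pos _).le
        refine Finset.prod_le_prod (fun i _ => Finset.sum_nonneg fun a _ =>
          mul_nonneg (hq i a) (Real.exp_pos _).le) fun i _ => ?_
        set m := ∑ a, q i a * Y i a with hm
        have h := sum_mul_exp_le (hq i) (hq1 i) (hY0 i) (hY1 i) (4 * t)
        calc ∑ a, q i a * Real.exp (4 * t * (Y i a - m))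
            = Real.exp (-(4 * t * m)) * ∑ a, q i a * Real.exp (4 * t * Y i a) := by
              rw [Finset.mul_sum]
              refine Finset.sum_congr rfl fun a _ => ?_
              rw [mul_left_comm, ← Real.exp_add]
              ring_nf
          _ ≤ Real.exp (-(4 * t * m)) * Real.exp (m * (4 * t) + (4 * t) ^ 2 / 8) :=
              mul_le_mul_of_nonneg_left h (Real.exp_pos _).le
          _ = Real.exp ((4 * t) ^ 2 / 8) := by rw [← Real.exp_add]; ring_nf
    _ = Real.exp (-(2 * N * t ^ 2)) := by
        rw [Finset.prod_const, ← Real.exp_nat_mul, ← Real.exp_add, Finset.card_univ]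
        congr 1
        ring

open Classical in
/-- Hoeffding's inequality for independent variables on finite spaces. -/
lemma hoeffding_two_sided [DecidableEq ι] {q Y : ι → α → ℝ} (hq : ∀ i a, 0 ≤ q i a)
    (hq1 : ∀ i, ∑ a, q i a = 1) (hY0 : ∀ i a, 0 ≤ Y i a) (hY1 : ∀ i a, Y i a ≤ 1)
    {t : ℝ} (ht : 0 ≤ t) :
    ∑ s : ι → α, (∏ i, q i (s i)) *
        (if (Fintype.card ι : ℝ) * t ≤ |∑ i, (Y i (s i) - ∑ a, q i a * Y i a)| then 1 else 0)
      ≤ 2 * Real.exp (-(2 * (Fintype.card ι : ℝ) * t ^ 2)) := by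
  have h1 := hoeffding_upper hq hq1 hY0 hY1 ht
  have h2 := hoeffding_upper (Y := fun i a => 1 - Y i a) hq hq1
    (fun i a => sub_nonneg.2 (hY1 i a)) (fun i a => sub_le_self _ (hY0 i a)) ht
  rw [two_mul]
  refine le_trans ?_ (add_le_add h1 h2)
  rw [← Finset.sum_add_distrib]
  refine Finset.sum_le_sum fun s _ => ?_
  rw [← mul_add]
  refine mul_le_mul_of_nonneg_left ?_ (Finset.prod_nonneg fun i _ => hq i _)
  have hneg : ∑ i, ((1 - Y i (s i)) - ∑ a, q i a * (1 - Y i a))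
      = -∑ i, (Y i (s i) - ∑ a, q i a * Y i a) := by
    rw [← Finset.sum_neg_distrib]
    refine Finset.sum_congr rfl fun i _ => ?_
    have : ∑ a, q i a * (1 - Y i a) = 1 - ∑ a, q i a * Y i a := by
      simp_rw [mul_sub, mul_one]
      rw [Finset.sum_sub_distrib, hq1 i]
    rw [this]; ring
  rw [hneg]
  split_ifs with ha hb hc hc <;> try norm_num
  rcases le_abs.1 ha with h | h
  · exact hb h
  · exact hc h

end Finite

/-! ### Poisson binomial counts -/

/-- The weight of the outcome `b` of a Bernoulli variable with parameter `p`. -/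
def bern (p : ℝ) (b : Bool) : ℝ := if b then p else 1 - p

lemma bern_nonneg {p : ℝ} (h0 : 0 ≤ p) (h1 : p ≤ 1) (b : Bool) : 0 ≤ bern p b := by
  cases b <;> simp [bern, h0, h1]

lemma sum_bern (p : ℝ) : ∑ b, bern p b = 1 := by simp [bern]

/-- The number of successes. -/
def count {ι : Type*} [Fintype ι] (b : ι → Bool) : ℝ := ∑ i, if b i then 1 else 0

section PoissonBinomial

variable {ι : Type*} [Fintype ι] {p : ι → ℝ}

lemma sum_bern_exp_count [DecidableEq ι] (p : ι → ℝ) (u : ℝ) :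
    ∑ b : ι → Bool, (∏ i, bern (p i) (b i)) * Real.exp (u * count b)
      = ∏ i, (1 + p i * (Real.exp u - 1)) := by
  have : ∀ b : ι → Bool, Real.exp (u * count b) = ∏ i, if b i then Real.exp u else 1 := by
    intro b
    rw [count, Finset.mul_sum, Real.exp_sum]
    refine Finset.prod_congr rfl fun i _ => ?_
    split_ifs <;> simp
  simp_rw [this]
  rw [sum_pi_mul_prod (fun i => bern (p i)) fun _ b => if b then Real.exp u else 1]
  refine Finset.prod_congr rfl fun i _ => ?_
  simp [bern]
  ring

open Classical in
lemma count_deviation [DecidableEq ι] (h0 : ∀ i, 0 ≤ p i) (h1 : ∀ i, p i ≤ 1) {t : ℝ} (ht : 0 ≤ t) :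
    ∑ b : ι → Bool, (∏ i, bern (p i) (b i)) *
        (if (Fintype.card ι : ℝ) * t ≤ |count b - ∑ i, p i| then 1 else 0)
      ≤ 2 * Real.exp (-(2 * (Fintype.card ι : ℝ) * t ^ 2)) := by
  have := hoeffding_two_sided (q := fun i => bern (p i)) (Y := fun _ b => if b then 1 else 0)
    (fun i a => bern_nonneg (h0 i) (h1 i) a) (fun i => sum_bern (p i))
    (fun i a => by split_ifs <;> norm_num) (fun i a => by split_ifs <;> norm_num) ht
  simpa [bern, count, Finset.sum_sub_distrib] using this

/-- The exponential of the count concentrates around its mean: its relative variance is small. -/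
lemma sum_bern_exp_count_sub_sq [DecidableEq ι] (h0 : ∀ i, 0 ≤ p i) {u : ℝ} (hu : 0 ≤ u)
    (A : ℝ) :
    ∑ b : ι → Bool, (∏ i, bern (p i) (b i)) *
        (A * Real.exp (u * count b) - A * ∏ i, (1 + p i * (Real.exp u - 1))) ^ 2
      ≤ (Real.exp ((Fintype.card ι : ℝ) * (Real.exp u - 1) ^ 2 / 4) - 1)
        * (A * ∏ i, (1 + p i * (Real.exp u - 1))) ^ 2 := by
  set z := Real.exp u with hz
  have hz1 : 1 ≤ z := Real.one_le_exp hu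
  set x := ∏ i, (1 + p i * (z - 1)) with hx
  have hxs := sum_bern_exp_count p u
  have hx2 := sum_bern_exp_count p (2 * u)
  have hz2 : Real.exp (2 * u) = z ^ 2 := by rw [hz, ← Real.exp_nat_mul]; norm_num
  rw [hz2] at hx2
  have hw := sum_pi_weight (q := fun i => bern (p i)) (fun i => sum_bern (p i))
  have hexp : ∑ b : ι → Bool, (∏ i, bern (p i) (b i)) * (A * Real.exp (u * count b) - A * x) ^ 2
      = A ^ 2 * ((∏ i, (1 + p i * (z ^ 2 - 1))) - x ^ 2) := by
    calc _ = A ^ 2 * (∑ b : ι → Bool, (∏ i, bern (p i) (b i)) * Real.exp (2 * u * count b))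
          - 2 * A ^ 2 * x * (∑ b : ι → Bool, (∏ i, bern (p i) (b i)) * Real.exp (u * count b))
          + A ^ 2 * x ^ 2 * ∑ b : ι → Bool, (∏ i, bern (p i) (b i)) := by
          simp only [Finset.mul_sum]
          rw [← Finset.sum_sub_distrib, ← Finset.sum_add_distrib]
          refine Finset.sum_congr rfl fun b _ => ?_
          have : Real.exp (2 * u * count b) = Real.exp (u * count b) ^ 2 := by
            rw [← Real.exp_nat_mul]; push_cast; ring_nf
          rw [this]; ring
      _ = _ := by rw [hx2, hxs, hw]; ring
  rw [hexp]
  have hfac : ∏ i, (1 + p i * (z ^ 2 - 1))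
      ≤ x ^ 2 * Real.exp ((Fintype.card ι : ℝ) * (z - 1) ^ 2 / 4) := by
    have : Real.exp ((Fintype.card ι : ℝ) * (z - 1) ^ 2 / 4)
        = ∏ _i : ι, Real.exp ((z - 1) ^ 2 / 4) := by
      rw [Finset.prod_const, ← Real.exp_nat_mul, Finset.card_univ, mul_div_assoc]
    rw [this, hx, ← Finset.prod_pow, ← Finset.prod_mul_distrib]
    refine Finset.prod_le_prod (fun i _ => ?_) fun i _ => ?_
    · have : 0 ≤ p i * (z ^ 2 - 1) := mul_nonneg (h0 i) (by nlinarith)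
      linarith
    · have e := Real.add_one_le_exp ((z - 1) ^ 2 / 4)
      have hy : 1 ≤ (1 + p i * (z - 1)) ^ 2 := by
        have : 0 ≤ p i * (z - 1) := mul_nonneg (h0 i) (by linarith)
        nlinarith
      -- The exact difference is p(1-p)(z-1)², at most (z-1)²/4. By `hy` this additive error is also
      -- a relative one.
      have hv : 1 + p i * (z ^ 2 - 1) ≤ (1 + p i * (z - 1)) ^ 2 + (z - 1) ^ 2 / 4 := by
        nlinarith [mul_nonneg (sq_nonneg (z - 1)) (sq_nonneg (p i - 1 / 2))]
      nlinarith [sq_nonneg (z - 1)]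
  nlinarith [mul_le_mul_of_nonneg_left hfac (sq_nonneg A)]

/-- Together with `exp_le_prod_bern` this pins the mean of exp(u·count) to exp(u·mean) up to
exp(card·u²/8), a constant factor when u is of order 1/√card. -/
lemma prod_bern_exp_le (h0 : ∀ i, 0 ≤ p i) (h1 : ∀ i, p i ≤ 1) (u : ℝ) :
    ∏ i, (1 + p i * (Real.exp u - 1))
      ≤ Real.exp ((∑ i, p i) * u + (Fintype.card ι : ℝ) * (u ^ 2 / 8)) := by
  calc _ ≤ ∏ i, Real.exp (p i * u + u ^ 2 / 8) :=
        Finset.prod_le_prod (fun i _ => le_trans (Real.exp_pos _).le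
          (exp_mul_le_of_mem_Icc (h0 i) (h1 i) u)) fun i _ => bernoulli_mgf_le (h0 i) (h1 i) u
    _ = _ := by
        rw [← Real.exp_sum, Finset.sum_add_distrib, Finset.sum_mul]
        simp

lemma exp_le_prod_bern (h0 : ∀ i, 0 ≤ p i) (h1 : ∀ i, p i ≤ 1) (u : ℝ) :
    Real.exp ((∑ i, p i) * u) ≤ ∏ i, (1 + p i * (Real.exp u - 1)) := by
  rw [Finset.sum_mul, Real.exp_sum]
  refine Finset.prod_le_prod (fun i _ => (Real.exp_pos _).le) fun i _ => ?_
  rw [mul_comm]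
  exact exp_mul_le_of_mem_Icc (h0 i) (h1 i) u

end PoissonBinomial

/-! ### Traces of positive semidefinite matrices -/

section Trace

variable {ν : Type*} [Fintype ν]

open scoped MatrixOrder Matrix.Norms.L2Operator in
lemma exists_eq_conjTranspose_mul_self {A : Matrix ν ν ℂ} (hA : A.PosSemidef) :
    ∃ B : Matrix ν ν ℂ, A = B.conjTranspose * B := by
  classical
  exact CStarAlgebra.nonneg_iff_eq_star_mul_self.mp hA.nonneg

lemma trace_mul_nonneg {A B : Matrix ν ν ℂ} (hA : A.PosSemidef) (hB : B.PosSemidef) :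
    0 ≤ (A * B).trace := by
  obtain ⟨Y, rfl⟩ := exists_eq_conjTranspose_mul_self hA
  rw [Matrix.mul_assoc, Matrix.trace_mul_comm]
  exact (hB.mul_mul_conjTranspose_same Y).trace_nonneg

lemma re_trace_mul_nonneg {A B : Matrix ν ν ℂ} (hA : A.PosSemidef) (hB : B.PosSemidef) :
    0 ≤ (A * B).trace.re :=
  (Complex.le_def.1 (trace_mul_nonneg hA hB)).1

lemma trace_mul_eq_re {A B : Matrix ν ν ℂ} (hA : A.PosSemidef) (hB : B.PosSemidef) :
    (A * B).trace = ((A * B).trace.re : ℂ) :=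
  Complex.ext rfl (Complex.le_def.1 (trace_mul_nonneg hA hB)).2.symm

lemma posSemidef_of_projection {P : Matrix ν ν ℂ} (hP : IsStarProjection P) : P.PosSemidef := by
  have h : P.conjTranspose = P := hP.isSelfAdjoint
  have := Matrix.posSemidef_conjTranspose_mul_self P
  rwa [h, hP.isIdempotentElem.eq] at this

lemma posSemidef_real_smul {A : Matrix ν ν ℂ} (hA : A.PosSemidef) {c : ℝ} (hc : 0 ≤ c) :
    ((c : ℂ) • A).PosSemidef :=
  hA.smul (Complex.zero_le_real.2 hc)

end Trace

/-! ### Probabilities as squared Frobenius norms -/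

section Frobenius

attribute [local instance] Matrix.frobeniusNormedAddCommGroup Matrix.frobeniusNormedSpace

variable {ν : Type*} [Fintype ν]

lemma frobenius_sq (A : Matrix ν ν ℂ) : ‖A‖ ^ 2 = (A.conjTranspose * A).trace.re := by
  rw [Matrix.frobenius_norm_def, ← Real.sqrt_eq_rpow, Real.sq_sqrt (by positivity),
    Matrix.trace, Finset.sum_comm, Complex.re_sum]
  refine Finset.sum_congr rfl fun j _ => ?_
  rw [Matrix.diag, Matrix.mul_apply, Complex.re_sum]
  refine Finset.sum_congr rfl fun i _ => ?_
  rw [Matrix.conjTranspose_apply, Complex.star_def, ← Complex.normSq_eq_conj_mul_self,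
    Complex.ofReal_re, Complex.normSq_eq_norm_sq, Real.rpow_two]

/-- For a state `A * Aᴴ` and an effect `Yᴴ * Y` this is the Born probability, so probabilities
become accessible to the triangle inequality. -/
lemma frobenius_mul_sq (Y A : Matrix ν ν ℂ) :
    ‖Y * A‖ ^ 2 = ((Y.conjTranspose * Y) * (A * A.conjTranspose)).trace.re := by
  rw [frobenius_sq, Matrix.conjTranspose_mul, Matrix.mul_assoc, Matrix.trace_mul_comm]
  simp only [Matrix.mul_assoc]

/-! ### Sequential tests

A sequence of two-outcome measurements with accepting effects `E t` and Kraus operators `R t` of the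
rejecting outcome is performed until the first acceptance. -/

variable [DecidableEq ν]

/-- The expected reward, as an effect, of performing the tests `t, t + 1, …, t + k - 1` until the
first acceptance: the reward is `w s` for acceptance at `s`, and `w₀` if all tests reject. -/
def seqEffect (E R : ℕ → Matrix ν ν ℂ) (w : ℕ → ℝ) (w₀ : ℝ) : ℕ → ℕ → Matrix ν ν ℂ
  | 0, _ => (w₀ : ℂ) • 1
  | k + 1, t => (w t : ℂ) • E t + (R t).conjTranspose * seqEffect E R w w₀ k (t + 1) * R t

variable {E R : ℕ → Matrix ν ν ℂ}

/-- Linearity in the reward turns indicator rewards into the effects of a single measurement. -/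
lemma seqEffect_add (w w' : ℕ → ℝ) (w₀ w₀' : ℝ) (k t : ℕ) :
    seqEffect E R (w + w') (w₀ + w₀') k t
      = seqEffect E R w w₀ k t + seqEffect E R w' w₀' k t := by
  induction k generalizing t with
  | zero => simp [seqEffect, add_smul]
  | succ k ih =>
    simp only [seqEffect, ih, Pi.add_apply, Complex.ofReal_add, add_smul, Matrix.mul_add,
      Matrix.add_mul]
    abel

lemma seqEffect_zero (k t : ℕ) : seqEffect E R 0 0 k t = 0 := by
  induction k generalizing t with
  | zero => simp [seqEffect]
  | succ k ih => simp [seqEffect, ih]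

lemma seqEffect_sum {β : Type*} (s : Finset β) (w : β → ℕ → ℝ) (w₀ : β → ℝ) (k t : ℕ) :
    seqEffect E R (∑ c ∈ s, w c) (∑ c ∈ s, w₀ c) k t
      = ∑ c ∈ s, seqEffect E R (w c) (w₀ c) k t := by
  classical
  induction s using Finset.induction_on with
  | empty => simp [seqEffect_zero]
  | insert a s ha ih => rw [Finset.sum_insert ha, Finset.sum_insert ha, Finset.sum_insert ha,
      seqEffect_add, ih]

lemma seqEffect_one (hR : ∀ t, (R t).conjTranspose * R t = 1 - E t) (k t : ℕ) :
    seqEffect E R 1 1 k t = 1 := by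
  induction k generalizing t with
  | zero => simp [seqEffect]
  | succ k ih => simp [seqEffect, ih, hR]

lemma seqEffect_posSemidef (hE : ∀ t, (E t).PosSemidef) {w : ℕ → ℝ} {w₀ : ℝ} (hw : ∀ t, 0 ≤ w t)
    (hw₀ : 0 ≤ w₀) (k t : ℕ) : (seqEffect E R w w₀ k t).PosSemidef := by
  induction k generalizing t with
  | zero => exact posSemidef_real_smul Matrix.PosSemidef.one hw₀
  | succ k ih =>
    exact (posSemidef_real_smul (hE t) (hw t)).add ((ih _).conjTranspose_mul_mul_same _)

lemma one_sub_seqEffect_posSemidef (hE : ∀ t, (E t).PosSemidef)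
    (hR : ∀ t, (R t).conjTranspose * R t = 1 - E t) {w : ℕ → ℝ} {w₀ : ℝ} (hw : ∀ t, w t ≤ 1)
    (hw₀ : w₀ ≤ 1) (k t : ℕ) : (1 - seqEffect E R w w₀ k t).PosSemidef := by
  have h := seqEffect_add (E := E) (R := R) w (1 - w) w₀ (1 - w₀) k t
  rw [add_sub_cancel, add_sub_cancel, seqEffect_one hR] at h
  rw [h, add_sub_cancel_left]
  exact seqEffect_posSemidef hE (fun t => sub_nonneg.2 (hw t)) (sub_nonneg.2 hw₀) k t

/-- The gap is 2D(√(x + y²) - y). A reward `x` is thus absorbed under the root while the disturbance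
`D` stays the same. -/
lemma sqrt_add_sq_le {x y D : ℝ} (hx : 0 ≤ x) (hD : 0 ≤ D) :
    x + (y + D) ^ 2 ≤ (Real.sqrt (x + y ^ 2) + D) ^ 2 := by
  have h1 : y ≤ Real.sqrt (x + y ^ 2) := Real.le_sqrt_of_sq_le (by linarith)
  have h2 := Real.sq_sqrt (show 0 ≤ x + y ^ 2 by positivity)
  nlinarith [mul_le_mul_of_nonneg_right h1 hD]

/-- If rejection disturbs the state by at most `κ` times a reference acceptance probability `p s`,
and test `t + N` has `p ≥ 1/2` and no reward, then the expected reward is bounded by the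
total reward that the tests before `t + N` would have on the undisturbed state, up to `1/2` and the
total disturbance `2κ`. -/
lemma seqEffect_trace_le (hE : ∀ t, (E t).PosSemidef)
    (hR : ∀ t, (R t).conjTranspose * R t = 1 - E t) {w : ℕ → ℝ} {w₀ : ℝ} (hw0 : ∀ t, 0 ≤ w t)
    (hw1 : ∀ t, w t ≤ 1) (hw₀0 : 0 ≤ w₀) (hw₀1 : w₀ ≤ 1) {M : Matrix ν ν ℂ} (hM : ‖M‖ = 1)
    {p : ℕ → ℝ} (hp0 : ∀ t, 0 ≤ p t) (hp1 : ∀ t, p t ≤ 1) {κ : ℝ} (hκ : 0 ≤ κ)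
    (hgentle : ∀ t, ‖R t * M - (Real.sqrt (1 - p t) : ℂ) • M‖ ≤ κ * p t) (N : ℕ) :
    ∀ k t : ℕ, N < k → 1 / 2 ≤ p (t + N) → w (t + N) = 0 →
      (seqEffect E R w w₀ k t * (M * M.conjTranspose)).trace.re
        ≤ (Real.sqrt (∑ s ∈ Finset.range N,
            w (t + s) * (E (t + s) * (M * M.conjTranspose)).trace.re + 1 / 2) + 2 * κ) ^ 2 := by
  have hMM : (M * M.conjTranspose).PosSemidef := Matrix.posSemidef_self_mul_conjTranspose M
  -- `Y` factors the effect of the remaining tests: it is a contraction, and the reward earned after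
  -- a rejection is a squared norm.
  have step : ∀ k t, ∃ Y : Matrix ν ν ℂ, (∀ A, ‖Y * A‖ ≤ ‖A‖) ∧
      Y.conjTranspose * Y = seqEffect E R w w₀ k (t + 1) ∧
      (seqEffect E R w w₀ (k + 1) t * (M * M.conjTranspose)).trace.re
        = w t * (E t * (M * M.conjTranspose)).trace.re + ‖Y * (R t * M)‖ ^ 2 := by
    intro k t
    obtain ⟨Y, hY⟩ := exists_eq_conjTranspose_mul_self
      (seqEffect_posSemidef (R := R) hE hw0 hw₀0 k (t + 1))
    refine ⟨Y, fun A => ?_, hY.symm, ?_⟩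
    · have h := re_trace_mul_nonneg
        (one_sub_seqEffect_posSemidef hE hR hw1 hw₀1 k (t + 1))
        (Matrix.posSemidef_self_mul_conjTranspose A)
      rw [hY, Matrix.sub_mul, Matrix.trace_sub, Complex.sub_re, ← frobenius_mul_sq, Matrix.one_mul,
        Matrix.trace_mul_comm, ← frobenius_sq] at h
      exact abs_le_of_sq_le_sq' (by linarith) (norm_nonneg A) |>.2
    · rw [frobenius_mul_sq, seqEffect, hY, Matrix.add_mul, Matrix.trace_add, Complex.add_re,
        Matrix.smul_mul, Matrix.trace_smul, smul_eq_mul, Complex.re_ofReal_mul]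
      congr 2
      rw [Matrix.conjTranspose_mul, Matrix.mul_assoc, Matrix.mul_assoc, Matrix.trace_mul_comm]
      simp only [Matrix.mul_assoc]
  have hsq : ∀ t, 0 ≤ Real.sqrt (1 - p t) ∧ Real.sqrt (1 - p t) ^ 2 = 1 - p t := fun t =>
    ⟨Real.sqrt_nonneg _, Real.sq_sqrt (sub_nonneg.2 (hp1 t))⟩
  induction N with
  | zero =>
    intro k t hk hp hwt
    obtain ⟨k, rfl⟩ := Nat.exists_eq_succ_of_ne_zero hk.ne'
    obtain ⟨Y, hYle, -, heq⟩ := step k t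
    rw [add_zero] at hp hwt
    rw [Nat.succ_eq_add_one, heq, hwt]
    simp only [Finset.range_zero, Finset.sum_empty, zero_mul, zero_add]
    refine pow_le_pow_left₀ (norm_nonneg _) ((hYle _).trans ?_) 2
    -- All that follows may earn the full reward 1, but the amplitude surviving this test is at most
    -- √(1/2) + κ.
    have h1 : ‖R t * M‖ ≤ κ * p t + Real.sqrt (1 - p t) := by
      have h2 := norm_sub_norm_le (R t * M) ((Real.sqrt (1 - p t) : ℂ) • M)
      have h3 : ‖(Real.sqrt (1 - p t) : ℂ) • M‖ = Real.sqrt (1 - p t) := by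
        rw [norm_smul, hM, mul_one, Complex.norm_real, Real.norm_of_nonneg (hsq t).1]
      rw [h3] at h2
      linarith [hgentle t]
    have h4 : Real.sqrt (1 - p t) ≤ Real.sqrt (1 / 2) := Real.sqrt_le_sqrt (by linarith)
    nlinarith [hp1 t]
  | succ N ih =>
    intro k t hk hp hwt
    obtain ⟨k, rfl⟩ := Nat.exists_eq_succ_of_ne_zero (Nat.ne_zero_of_lt hk)
    obtain ⟨Y, hYle, hY, heq⟩ := step k t
    have ht : t + 1 + N = t + (N + 1) := by ring
    have hI := ih k (t + 1) (by omega) (by rwa [ht]) (by rwa [ht])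
    rw [← hY, ← frobenius_mul_sq] at hI
    rw [Finset.sum_range_succ', add_zero, Nat.succ_eq_add_one, heq]
    set x := w t * (E t * (M * M.conjTranspose)).trace.re with hx
    have hx0 : 0 ≤ x := mul_nonneg (hw0 t) (re_trace_mul_nonneg (hE t) hMM)
    have hsum : ∑ s ∈ Finset.range N, w (t + (s + 1)) *
        (E (t + (s + 1)) * (M * M.conjTranspose)).trace.re
        = ∑ s ∈ Finset.range N, w (t + 1 + s) *
          (E (t + 1 + s) * (M * M.conjTranspose)).trace.re :=
      Finset.sum_congr rfl fun s _ => by rw [show t + (s + 1) = t + 1 + s by ring]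
    rw [hsum]
    set S := ∑ s ∈ Finset.range N, w (t + 1 + s) *
          (E (t + 1 + s) * (M * M.conjTranspose)).trace.re with hS
    have hS0 : 0 ≤ S := Finset.sum_nonneg fun s _ =>
      mul_nonneg (hw0 _) (re_trace_mul_nonneg (hE _) hMM)
    have hβ : 0 ≤ Real.sqrt (S + 1 / 2) := Real.sqrt_nonneg _
    have hI' : ‖Y * M‖ ≤ Real.sqrt (S + 1 / 2) + 2 * κ :=
      abs_le_of_sq_le_sq' hI (by positivity) |>.2
    obtain ⟨hr0, hr2⟩ := hsq t
    set r := Real.sqrt (1 - p t) with hr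
    -- The damping pays for the disturbance: r·2κ + κp ≤ 2κ.
    have hr1 : r ≤ 1 - p t / 2 := by nlinarith [hp0 t, hp1 t]
    have hYR : ‖Y * (R t * M)‖ ≤ Real.sqrt (S + 1 / 2) + 2 * κ := by
      have e : Y * (R t * M) = (r : ℂ) • (Y * M) + Y * (R t * M - (r : ℂ) • M) := by
        rw [Matrix.mul_sub, Matrix.mul_smul]; abel
      rw [e]
      refine (norm_add_le _ _).trans ?_
      have h1 : ‖(r : ℂ) • (Y * M)‖ = r * ‖Y * M‖ := by
        rw [norm_smul, Complex.norm_real, Real.norm_of_nonneg hr0]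
      have h2 := (hYle (R t * M - (r : ℂ) • M)).trans (hgentle t)
      rw [h1]
      have h3 := mul_le_mul_of_nonneg_left hI' hr0
      have h4 := mul_le_mul_of_nonneg_right hr1 (by positivity : 0 ≤ 2 * κ)
      have h5 : r ≤ 1 := by linarith [hp0 t]
      nlinarith
    have hfin := sqrt_add_sq_le (y := Real.sqrt (S + 1 / 2)) hx0 (by positivity : 0 ≤ 2 * κ)
    rw [Real.sq_sqrt (by positivity)] at hfin
    rw [show S + x + 1 / 2 = x + (S + 1 / 2) by ring]
    refine le_trans ?_ hfin
    have := pow_le_pow_left₀ (norm_nonneg _) hYR 2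
    linarith

end Frobenius

/-! ### Projective measurements -/

/-- A projective measurement with outcomes in `β`. -/
structure IsPVM {β ν : Type*} [Fintype β] [DecidableEq β] [Fintype ν] [DecidableEq ν]
    (Q : β → Matrix ν ν ℂ) : Prop where
  conjTranspose : ∀ b, (Q b).conjTranspose = Q b
  mul : ∀ b b', Q b * Q b' = if b = b' then Q b else 0
  sum : ∑ b, Q b = 1

/-- The real function `f` of the outcome of the measurement `Q`, as an observable. -/
noncomputable def observable {β ν : Type*} [Fintype β] (Q : β → Matrix ν ν ℂ) (f : β → ℝ) :
    Matrix ν ν ℂ :=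
  ∑ b, (f b : ℂ) • Q b

section PVM

variable {β ν : Type*} [Fintype β] [DecidableEq β] [Fintype ν] [DecidableEq ν]
  {Q : β → Matrix ν ν ℂ}

lemma IsPVM.posSemidef (hQ : IsPVM Q) (b : β) : (Q b).PosSemidef := by
  have := Matrix.posSemidef_conjTranspose_mul_self (Q b)
  rwa [hQ.conjTranspose, hQ.mul, if_pos rfl] at this

lemma observable_posSemidef (hQ : IsPVM Q) {f : β → ℝ} (hf : ∀ b, 0 ≤ f b) :
    (observable Q f).PosSemidef :=
  Matrix.posSemidef_sum _ fun b _ => posSemidef_real_smul (hQ.posSemidef b) (hf b)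

lemma observable_conjTranspose (hQ : IsPVM Q) (f : β → ℝ) :
    (observable Q f).conjTranspose = observable Q f := by
  simp [observable, Matrix.conjTranspose_sum, hQ.conjTranspose]

lemma observable_mul (hQ : IsPVM Q) (f g : β → ℝ) :
    observable Q f * observable Q g = observable Q (f * g) := by
  simp only [observable, Finset.sum_mul, Finset.mul_sum, Matrix.smul_mul, Matrix.mul_smul, hQ.mul]
  refine Finset.sum_congr rfl fun b _ => ?_
  simp only [smul_ite, smul_zero, Finset.sum_ite_eq', Finset.mem_univ, if_true,
    smul_smul, Pi.mul_apply, Complex.ofReal_mul, mul_comm]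

lemma observable_const (hQ : IsPVM Q) (c : ℝ) : observable Q (fun _ => c) = (c : ℂ) • 1 := by
  rw [observable, ← Finset.smul_sum, hQ.sum]

lemma observable_sub (f g : β → ℝ) :
    observable Q (f - g) = observable Q f - observable Q g := by
  simp [observable, sub_smul, Finset.sum_sub_distrib]

lemma trace_observable_mul (f : β → ℝ) (σ : Matrix ν ν ℂ) :
    (observable Q f * σ).trace.re = ∑ b, f b * (Q b * σ).trace.re := by
  simp [observable, Finset.sum_mul, Matrix.trace_sum]

attribute [local instance] Matrix.frobeniusNormedAddCommGroup Matrix.frobeniusNormedSpace in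
lemma observable_sub_const_norm_sq (hQ : IsPVM Q) (f : β → ℝ) (c : ℝ) (M : Matrix ν ν ℂ) :
    ‖observable Q f * M - (c : ℂ) • M‖ ^ 2
      = ∑ b, (f b - c) ^ 2 * (Q b * (M * M.conjTranspose)).trace.re := by
  have : observable Q f * M - (c : ℂ) • M = observable Q (f - fun _ => c) * M := by
    rw [observable_sub, observable_const hQ, Matrix.sub_mul, Matrix.smul_mul, Matrix.one_mul]
  rw [this, frobenius_mul_sq, observable_conjTranspose hQ, observable_mul hQ, trace_observable_mul]
  simp [sq]

end PVM

/-! ### Tensor products of families of matrices -/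

/-- The tensor product of a finite family of square matrices. -/
def tensorFamily {ι κ : Type*} [Fintype ι] (A : ι → Matrix κ κ ℂ) : Matrix (ι → κ) (ι → κ) ℂ :=
  Matrix.of fun a b => ∏ i, A i (a i) (b i)

section Tensor

variable {ι κ : Type*} [Fintype ι] [DecidableEq ι] [Fintype κ]

lemma tensorFamily_mul (A B : ι → Matrix κ κ ℂ) :
    tensorFamily A * tensorFamily B = tensorFamily fun i => A i * B i := by
  ext a b
  simp only [tensorFamily, Matrix.mul_apply, Matrix.of_apply, Fintype.prod_sum,
    Finset.prod_mul_distrib]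

lemma tensorFamily_trace (A : ι → Matrix κ κ ℂ) :
    (tensorFamily A).trace = ∏ i, (A i).trace := by
  simp only [tensorFamily, Matrix.trace, Matrix.diag, Matrix.of_apply, Fintype.prod_sum]

lemma tensorFamily_conjTranspose (A : ι → Matrix κ κ ℂ) :
    (tensorFamily A).conjTranspose = tensorFamily fun i => (A i).conjTranspose := by
  ext a b
  simp [tensorFamily, Matrix.conjTranspose_apply]

lemma tensorFamily_one [DecidableEq κ] :
    tensorFamily (fun _ : ι => (1 : Matrix κ κ ℂ)) = 1 := by
  ext a b
  simp only [tensorFamily, Matrix.of_apply, Matrix.one_apply, Finset.prod_ite_zero]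
  simp [funext_iff]

lemma tensorFamily_sum {β : Type*} [Fintype β] (A : ι → β → Matrix κ κ ℂ) :
    ∑ f : ι → β, tensorFamily (fun i => A i (f i)) = tensorFamily fun i => ∑ x, A i x := by
  ext a b
  simp only [tensorFamily, Matrix.sum_apply, Matrix.of_apply, Fintype.prod_sum]

lemma tensorFamily_posSemidef {A : ι → Matrix κ κ ℂ} (hA : ∀ i, (A i).PosSemidef) :
    (tensorFamily A).PosSemidef := by
  choose B hB using fun i => exists_eq_conjTranspose_mul_self (hA i)
  have : A = fun i => (B i).conjTranspose * B i := funext hB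
  rw [this, ← tensorFamily_mul, ← tensorFamily_conjTranspose]
  exact Matrix.posSemidef_conjTranspose_mul_self _

lemma tensorFamily_trace_mul_re {A B : ι → Matrix κ κ ℂ} (hA : ∀ i, (A i).PosSemidef)
    (hB : ∀ i, (B i).PosSemidef) :
    (tensorFamily A * tensorFamily B).trace.re = ∏ i, (A i * B i).trace.re := by
  rw [tensorFamily_mul, tensorFamily_trace,
    Finset.prod_congr rfl fun i _ => trace_mul_eq_re (hA i) (hB i), ← Complex.ofReal_prod,
    Complex.ofReal_re]

/-- The joint measurement of a family of projectors. -/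
def jointPVM [DecidableEq κ] (P : ι → Matrix κ κ ℂ) (b : ι → Bool) : Matrix (ι → κ) (ι → κ) ℂ :=
  tensorFamily fun i => if b i then P i else 1 - P i

variable [DecidableEq κ] {P : ι → Matrix κ κ ℂ}

lemma jointPVM_isPVM (hP : ∀ i, IsStarProjection (P i)) : IsPVM (jointPVM P) := by
  have hc : ∀ i, (P i).conjTranspose = P i := fun i => (hP i).isSelfAdjoint
  have hm : ∀ i, P i * P i = P i := fun i => (hP i).isIdempotentElem
  refine ⟨fun b => ?_, fun b b' => ?_, ?_⟩
  · rw [jointPVM, tensorFamily_conjTranspose]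
    congr 1
    funext i
    split_ifs <;> simp [hc]
  · rw [jointPVM, jointPVM, tensorFamily_mul]
    split_ifs with h
    · subst h
      congr 1
      funext i
      split_ifs
      · exact hm i
      · simp [Matrix.sub_mul, Matrix.mul_sub, hm]
    · obtain ⟨i, hi⟩ := Function.ne_iff.1 h
      ext a c
      rw [tensorFamily, Matrix.of_apply, Matrix.zero_apply]
      refine Finset.prod_eq_zero (Finset.mem_univ i) ?_
      have : ((if b i then P i else 1 - P i) * if b' i then P i else 1 - P i) = 0 := by
        cases hb : b i <;> cases hb' : b' i <;>
          simp_all [Matrix.sub_mul, Matrix.mul_sub]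
      rw [this, Matrix.zero_apply]
  · have := tensorFamily_sum fun (i : ι) (x : Bool) => if x then P i else 1 - P i
    simp only [jointPVM]
    rw [this]
    simp only [Fintype.sum_bool, if_true, Bool.false_eq_true, if_false, add_sub_cancel]
    exact tensorFamily_one

/-- On a product state the outcomes are independent Bernoulli variables, so testing one concept is
governed by Poisson binomial counts. -/
lemma jointPVM_trace {ρ : ι → Matrix κ κ ℂ} (hP : ∀ i, IsStarProjection (P i))
    (hρ : ∀ i, (ρ i).PosSemidef) (hρ1 : ∀ i, (ρ i).trace = 1) (b : ι → Bool) :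
    (jointPVM P b * tensorFamily ρ).trace.re = ∏ i, bern (ρ i * P i).trace.re (b i) := by
  rw [jointPVM, tensorFamily_trace_mul_re _ hρ]
  · refine Finset.prod_congr rfl fun i _ => ?_
    unfold bern
    split_ifs
    · rw [Matrix.trace_mul_comm]
    · rw [Matrix.sub_mul, Matrix.trace_sub, Matrix.one_mul, hρ1, Matrix.trace_mul_comm]
      simp
  · intro i
    split_ifs
    · exact posSemidef_of_projection (hP i)
    · exact posSemidef_of_projection (hP i).one_sub

end Tensor

lemma trace_projection_mem_Icc {κ : Type*} [Fintype κ] [DecidableEq κ] {ρ P : Matrix κ κ ℂ}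
    (hP : IsStarProjection P) (hρ : ρ.PosSemidef) (hρ1 : ρ.trace = 1) :
    0 ≤ (ρ * P).trace.re ∧ (ρ * P).trace.re ≤ 1 := by
  refine ⟨re_trace_mul_nonneg hρ (posSemidef_of_projection hP), ?_⟩
  have := re_trace_mul_nonneg hρ (posSemidef_of_projection hP.one_sub)
  rw [Matrix.mul_sub, Matrix.mul_one, Matrix.trace_sub, hρ1] at this
  simpa using this

/-! ### Searching for a concept of nearly maximal value in one block -/

/-- 1/√(1+h) is the amplitude of rejection at odds `h`. With a = √(1+h) and c = √(1+x) the claim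
reduces to c ≤ a(a + c), which holds since a ≥ 1. -/
lemma inv_sqrt_sub_sq_le {h x : ℝ} (hh : 0 ≤ h) (hx : 0 ≤ x) :
    (1 / Real.sqrt (1 + h) - Real.sqrt (1 - x / (1 + x))) ^ 2 ≤ (h - x) ^ 2 / (1 + x) ^ 2 := by
  have e : Real.sqrt (1 - x / (1 + x)) = 1 / Real.sqrt (1 + x) := by
    rw [← Real.sqrt_one, ← Real.sqrt_div zero_le_one, Real.sqrt_one]
    congr 1
    field_simp
    ring
  rw [e]
  have ha := Real.sq_sqrt (show 0 ≤ 1 + h by linarith)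
  have hc := Real.sq_sqrt (show 0 ≤ 1 + x by linarith)
  have ha1 : 1 ≤ Real.sqrt (1 + h) := Real.one_le_sqrt.2 (by linarith)
  have hc1 : 1 ≤ Real.sqrt (1 + x) := Real.one_le_sqrt.2 (by linarith)
  set a := Real.sqrt (1 + h)
  set c := Real.sqrt (1 + x)
  have e1 : (h - x) ^ 2 = (a - c) ^ 2 * (a + c) ^ 2 := by
    rw [show h = a ^ 2 - 1 by linarith, show x = c ^ 2 - 1 by linarith]; ring
  rw [e1, ← hc, div_sub_div _ _ (by positivity) (by positivity), div_pow, div_le_div_iff₀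
    (by positivity) (by positivity)]
  have h1 : c ≤ a * (a + c) := by nlinarith
  have h2 : c ^ 2 ≤ (a * (a + c)) ^ 2 := pow_le_pow_left₀ (by positivity) h1 2
  nlinarith [mul_le_mul_of_nonneg_left h2 (show 0 ≤ (a - c) ^ 2 * c ^ 2 by positivity)]

section

attribute [local instance] Matrix.frobeniusNormedAddCommGroup Matrix.frobeniusNormedSpace

variable {β ν : Type*} [Fintype β] [DecidableEq β] [Fintype ν] [DecidableEq ν]
  {Q : β → Matrix ν ν ℂ}

/-- The logistic test with odds `h` disturbs a state little when the odds have small relative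
variance. -/
lemma logistic_test_gentle (hQ : IsPVM Q) {h : β → ℝ} (hh : ∀ b, 0 ≤ h b) {x κ : ℝ} (hx : 0 ≤ x)
    (hκ : 0 ≤ κ) (M : Matrix ν ν ℂ)
    (hvar : ∑ b, (Q b * (M * M.conjTranspose)).trace.re * (h b - x) ^ 2 ≤ κ ^ 2 * x ^ 2) :
    ‖observable Q (fun b => 1 / Real.sqrt (1 + h b)) * M
      - (Real.sqrt (1 - x / (1 + x)) : ℂ) • M‖ ≤ κ * (x / (1 + x)) := by
  refine abs_le_of_sq_le_sq' ?_ (by positivity) |>.2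
  rw [observable_sub_const_norm_sq hQ]
  calc _ ≤ ∑ b, (h b - x) ^ 2 / (1 + x) ^ 2 * (Q b * (M * M.conjTranspose)).trace.re :=
        Finset.sum_le_sum fun b _ => mul_le_mul_of_nonneg_right (inv_sqrt_sub_sq_le (hh b) hx)
          (re_trace_mul_nonneg (hQ.posSemidef b) (Matrix.posSemidef_self_mul_conjTranspose M))
    _ = (∑ b, (Q b * (M * M.conjTranspose)).trace.re * (h b - x) ^ 2) / (1 + x) ^ 2 := by
        rw [Finset.sum_div]
        exact Finset.sum_congr rfl fun b _ => by ring
    _ ≤ κ ^ 2 * x ^ 2 / (1 + x) ^ 2 := by gcongr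
    _ = _ := by rw [mul_pow, div_pow]; ring

lemma logistic_test_kraus (hQ : IsPVM Q) {h : β → ℝ} (hh : ∀ b, 0 ≤ h b) :
    (observable Q fun b => 1 / Real.sqrt (1 + h b)).conjTranspose
        * (observable Q fun b => 1 / Real.sqrt (1 + h b))
      = 1 - observable Q fun b => h b / (1 + h b) := by
  have h1 : (1 : Matrix ν ν ℂ) = observable Q fun _ => 1 := by simp [observable_const hQ]
  rw [observable_conjTranspose hQ, observable_mul hQ, h1, ← observable_sub]
  congr 1
  funext b
  have := hh b
  simp only [Pi.mul_apply, Pi.sub_apply]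
  rw [div_mul_div_comm, Real.mul_self_sqrt (by linarith)]
  field_simp
  ring

lemma logistic_test_trace_le (hQ : IsPVM Q) {h : β → ℝ} (hh : ∀ b, 0 ≤ h b) {σ : Matrix ν ν ℂ}
    (hσ : σ.PosSemidef) :
    ((observable Q fun b => h b / (1 + h b)) * σ).trace.re ≤ ∑ b, (Q b * σ).trace.re * h b := by
  rw [trace_observable_mul]
  refine Finset.sum_le_sum fun b _ => ?_
  rw [mul_comm]
  refine mul_le_mul_of_nonneg_left ?_ (re_trace_mul_nonneg (hQ.posSemidef b) hσ)
  exact div_le_self (hh b) (by linarith [hh b])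

end

/-! ### Numerical estimates for the search -/

lemma sum_pow_sub_le {q : ℝ} (h0 : 0 ≤ q) (h1 : q ≤ 1 / 2) (n : ℕ) :
    ∑ j ∈ Finset.range n, q ^ (n - j) ≤ 2 * q := by
  induction n with
  | zero => simpa using h0
  | succ n ih =>
    rw [Finset.sum_range_succ]
    have : ∑ j ∈ Finset.range n, q ^ (n + 1 - j) = q * ∑ j ∈ Finset.range n, q ^ (n - j) := by
      rw [Finset.mul_sum]
      refine Finset.sum_congr rfl fun j hj => ?_
      rw [← pow_succ', Nat.succ_sub (Finset.mem_range.1 hj).le]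
    rw [this, Nat.add_sub_cancel_left, pow_one]
    nlinarith

/-- Each threshold index t / m is shared by m consecutive tests. -/
lemma sum_range_mul_div {m : ℕ} (hm : 0 < m) (g : ℕ → ℝ) (n : ℕ) :
    ∑ t ∈ Finset.range (m * n), g (t / m) = m * ∑ j ∈ Finset.range n, g j := by
  induction n with
  | zero => simp
  | succ n ih =>
    rw [Nat.mul_succ, Finset.sum_range_add, ih, Finset.sum_range_succ, mul_add]
    congr 1
    rw [Finset.sum_congr rfl fun x hx => by
      rw [Nat.mul_add_div hm, Nat.div_eq_of_lt (Finset.mem_range.1 hx), add_zero]]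
    simp

/-- The inverse temperature of the tests on a block of length `l`. -/
noncomputable def testScale (l : ℕ) : ℝ := 1 / (10 * Real.sqrt l)

lemma testScale_sq {l : ℕ} (hl : 0 < l) : (l : ℝ) * testScale l ^ 2 = 1 / 100 := by
  have hl' : (0 : ℝ) < l := Nat.cast_pos.2 hl
  rw [testScale, div_pow, mul_pow, Real.sq_sqrt hl'.le]
  field_simp
  norm_num

/-- This fixes the scale: l·u² = 1/100 brings the relative variance of the odds below κ² with κ =
0.07. -/
lemma testScale_variance {l : ℕ} (hl : 0 < l) :
    Real.exp ((l : ℝ) * (Real.exp (testScale l) - 1) ^ 2 / 4) - 1 ≤ 0.07 ^ 2 := by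
  have h2 := testScale_sq hl
  have hl' : (1 : ℝ) ≤ l := Nat.one_le_cast.2 hl
  have hu : 0 ≤ testScale l := by unfold testScale; positivity
  set u := testScale l
  have hu1 : u ≤ 1 / 10 := by nlinarith
  have h3 := Real.abs_exp_sub_one_sub_id_le (x := u) (by rw [abs_of_nonneg hu]; linarith)
  have h4 : Real.exp u - 1 ≤ 1.1 * u := by nlinarith [(abs_le.1 h3).2]
  have h5 : 0 ≤ Real.exp u - 1 := by linarith [Real.add_one_le_exp u]
  have h6 : (l : ℝ) * (Real.exp u - 1) ^ 2 / 4 ≤ 0.0031 := by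
    have : (Real.exp u - 1) ^ 2 ≤ (1.1 * u) ^ 2 := pow_le_pow_left₀ h5 h4 2
    nlinarith
  have h7 : 0 ≤ (l : ℝ) * (Real.exp u - 1) ^ 2 / 4 := by positivity
  have h8 := Real.abs_exp_sub_one_sub_id_le (x := (l : ℝ) * (Real.exp u - 1) ^ 2 / 4)
    (by rw [abs_of_nonneg h7]; linarith)
  nlinarith [(abs_le.1 h8).2]

/-- The exponent u·l·ε/4 equals √l·ε/40, hence 1/1600 = 1/40² in the condition. It is then at least
log m + 5, and e⁻⁵ < 0.007. -/
lemma testScale_exp_le {m l : ℕ} (hm : 0 < m) (hl : 0 < l) {ε : ℝ} (hε : 0 < ε)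
    (hcond : (Real.log m + 5) ^ 2 ≤ 1 / 1600 * (l : ℝ) * ε ^ 2) :
    (m : ℝ) * Real.exp (-(testScale l * l * (ε / 4))) ≤ 0.007 := by
  have hl' : (0 : ℝ) < l := Nat.cast_pos.2 hl
  have hm' : (0 : ℝ) < m := Nat.cast_pos.2 hm
  have hs := Real.sq_sqrt hl'.le
  have hs0 : 0 < Real.sqrt l := Real.sqrt_pos.2 hl'
  have e : testScale l * l * (ε / 4) = Real.sqrt l * ε / 40 := by
    rw [testScale]
    field_simp
    rw [hs]
    ring
  have h1 : Real.log m + 5 ≤ Real.sqrt l * ε / 40 := by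
    refine (abs_le_of_sq_le_sq' ?_ (by positivity)).2
    rw [div_pow, mul_pow, hs]
    linarith
  rw [e]
  calc (m : ℝ) * Real.exp (-(Real.sqrt l * ε / 40))
      ≤ m * Real.exp (-(Real.log m + 5)) := by gcongr
    _ = Real.exp (-5) := by
        rw [neg_add, Real.exp_add, Real.exp_neg, Real.exp_log hm', mul_inv_cancel_left₀ hm'.ne']
    _ ≤ 0.007 := by
        rw [Real.exp_neg]
        have h3 : Real.exp 5 = Real.exp 1 ^ 5 := by rw [← Real.exp_nat_mul]; norm_num
        have h4 : (2.7 : ℝ) ^ 5 ≤ Real.exp 1 ^ 5 :=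
          pow_le_pow_left₀ (by norm_num) (by linarith [Real.exp_one_gt_d9]) 5
        rw [h3]
        calc (Real.exp 1 ^ 5)⁻¹ ≤ ((2.7 : ℝ) ^ 5)⁻¹ := inv_anti₀ (by norm_num) h4
          _ ≤ 0.007 := by norm_num

/-- Here 0.02 is the budget for false acceptances, 1/2 the loss at the decisive test, and 0.07 the
value of κ. -/
lemma search_bound {S : ℝ} (hS : S ≤ 0.02) :
    (Real.sqrt (S + 1 / 2) + 2 * 0.07) ^ 2 ≤ 3 / 4 := by
  have h : Real.sqrt (S + 1 / 2) ≤ 0.7212 := Real.sqrt_le_iff.2 ⟨by norm_num, by linarith⟩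
  nlinarith [Real.sqrt_nonneg (S + 1 / 2)]

attribute [local instance] Matrix.frobeniusNormedAddCommGroup Matrix.frobeniusNormedSpace in
open Classical in
/-- On a block of length `l` at least of order `(log m)² / ε²` there is a measurement that finds,
with constant probability, a concept whose total value on the block is within `lε/2` of the
maximum. -/
theorem exists_search_measurement {d m l : ℕ} (hm : 0 < m) (hl : 0 < l) {ε : ℝ} (hε : 0 < ε)
    (hcond : (Real.log m + 5) ^ 2 ≤ 1 / 1600 * (l : ℝ) * ε ^ 2)
    {P : Fin m → Fin l → Op d} (hP : ∀ c i, IsStarProjection (P c i)) :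
    ∃ F : Fin m → RegOp d l, (∀ c, (F c).PosSemidef) ∧ ∑ c, F c = 1 ∧
      ∀ ρ : Fin l → Op d, (∀ i, IsDensity (ρ i)) →
        ∑ c, (if ∀ c', ∑ i, (ρ i * P c' i).trace.re
            ≤ ∑ i, (ρ i * P c i).trace.re + l * (ε / 2) then 0 else 1)
          * (F c * productState ρ).trace.re ≤ 3 / 4 := by
  have hl' : (0 : ℝ) < l := Nat.cast_pos.2 hl
  set u := testScale l with hu
  have hu0 : 0 ≤ u := by rw [hu, testScale]; positivity
  -- Test `t` concerns concept t mod m at threshold number t / m; `h t` are its odds of acceptance.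
  let con : ℕ → Fin m := fun t => ⟨t % m, Nat.mod_lt _ hm⟩
  let θ : ℕ → ℝ := fun j => 1 - j * (ε / 4)
  let h : ℕ → (Fin l → Bool) → ℝ := fun t b => Real.exp (-(u * (θ (t / m) * l))) *
    Real.exp (u * count b)
  have hh : ∀ t b, 0 ≤ h t b := fun t b => by positivity
  have hQ : ∀ c, IsPVM (jointPVM (P c)) := fun c => jointPVM_isPVM (hP c)
  let E : ℕ → RegOp d l := fun t => observable (jointPVM (P (con t))) fun b => h t b / (1 + h t b)
  let R : ℕ → RegOp d l := fun t =>
    observable (jointPVM (P (con t))) fun b => 1 / Real.sqrt (1 + h t b)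
  have hE : ∀ t, (E t).PosSemidef := fun t =>
    observable_posSemidef (hQ _) fun b => div_nonneg (hh t b) (by linarith [hh t b])
  have hR : ∀ t, (R t).conjTranspose * R t = 1 - E t := fun t => logistic_test_kraus (hQ _) (hh t)
  -- The last threshold, number ⌈4/ε⌉, is at most 0 and so below every value; the 1 counts threshold
  -- number 0.
  let J : ℕ := ⌈4 / ε⌉₊ + 1
  let w : Fin m → ℕ → ℝ := fun c t => if con t = c then 1 else 0
  -- Concept 0 is reported by default when all tests reject.
  let w₀ : Fin m → ℝ := fun c => if (⟨0, hm⟩ : Fin m) = c then 1 else 0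
  refine ⟨fun c => seqEffect E R (w c) (w₀ c) (m * J) 0, fun c => ?_, ?_, fun ρ hρ => ?_⟩
  · refine seqEffect_posSemidef hE (fun t => ?_) ?_ _ _
    · simp only [w]; split_ifs <;> norm_num
    · simp only [w₀]; split_ifs <;> norm_num
  · rw [← seqEffect_sum]
    have e1 : ∑ c, w c = 1 := by
      funext t
      simp [w]
    have e2 : ∑ c, w₀ c = 1 := by simp [w₀]
    rw [e1, e2, seqEffect_one hR]
  let p : Fin m → Fin l → ℝ := fun c i => (ρ i * P c i).trace.re
  have hp : ∀ c i, 0 ≤ p c i ∧ p c i ≤ 1 := fun c i =>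
    trace_projection_mem_Icc (hP c i) (hρ i).1 (hρ i).2
  let S : Fin m → ℝ := fun c => ∑ i, p c i
  let good : Fin m → Prop := fun c => ∀ c', S c' ≤ S c + l * (ε / 2)
  change ∑ c, (if good c then (0 : ℝ) else 1) *
    (seqEffect E R (w c) (w₀ c) (m * J) 0 * productState ρ).trace.re ≤ 3 / 4
  have hσ : (productState ρ).PosSemidef := tensorFamily_posSemidef fun i => (hρ i).1
  obtain ⟨B, hB⟩ := exists_eq_conjTranspose_mul_self hσ
  let M := B.conjTranspose
  have hM : M * M.conjTranspose = productState ρ := by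
    simp only [M, Matrix.conjTranspose_conjTranspose, hB]
  have hM1 : ‖M‖ = 1 := by
    have : ‖M‖ ^ 2 = 1 := by
      rw [frobenius_sq, Matrix.trace_mul_comm, hM]
      change (tensorFamily ρ).trace.re = 1
      rw [tensorFamily_trace]
      simp [(hρ _).2]
    nlinarith [norm_nonneg M]
  have hπ : ∀ c b, (jointPVM (P c) b * productState ρ).trace.re = ∏ i, bern (p c i) (b i) :=
    fun c b => jointPVM_trace (hP c) (fun i => (hρ i).1) (fun i => (hρ i).2) b
  -- the mean odds of the tests
  let x : ℕ → ℝ := fun t => Real.exp (-(u * (θ (t / m) * l))) *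
    ∏ i, (1 + p (con t) i * (Real.exp u - 1))
  have hprod : ∀ c, Real.exp (S c * u) ≤ ∏ i, (1 + p c i * (Real.exp u - 1)) := fun c =>
    exp_le_prod_bern (fun i => (hp c i).1) (fun i => (hp c i).2) u
  have hx0 : ∀ t, 0 ≤ x t := fun t =>
    mul_nonneg (Real.exp_pos _).le ((Real.exp_pos _).le.trans (hprod _))
  have hgentle : ∀ t, ‖R t * M - (Real.sqrt (1 - x t / (1 + x t)) : ℂ) • M‖
      ≤ 0.07 * (x t / (1 + x t)) := by
    intro t
    refine logistic_test_gentle (hQ _) (hh t) (hx0 t) (by norm_num) M ?_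
    simp only [hM, hπ]
    refine (sum_bern_exp_count_sub_sq (fun i => (hp (con t) i).1) hu0 _).trans ?_
    refine mul_le_mul_of_nonneg_right ?_ (sq_nonneg _)
    rw [Fintype.card_fin]
    exact testScale_variance hl
  have hEx : ∀ t, (E t * productState ρ).trace.re ≤ x t := by
    intro t
    refine (logistic_test_trace_le (hQ _) (hh t) hσ).trans (le_of_eq ?_)
    simp only [hπ, h, x]
    rw [← sum_bern_exp_count, Finset.mul_sum]
    exact Finset.sum_congr rfl fun b _ => by ring
  -- the best concept and the first threshold below its value
  obtain ⟨cmax, -, hcmax⟩ := Finset.exists_max_image Finset.univ S ⟨⟨0, hm⟩, Finset.mem_univ _⟩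
  have hS0 : 0 ≤ S cmax := Finset.sum_nonneg fun i _ => (hp cmax i).1
  have hSl : S cmax ≤ l := by
    have : S cmax ≤ ∑ _i : Fin l, (1 : ℝ) := Finset.sum_le_sum fun i _ => (hp cmax i).2
    simpa using this
  set y := (1 - S cmax / l) * (4 / ε) with hy
  have hSd : S cmax / l ≤ 1 := (div_le_one hl').2 hSl
  have hy0 : 0 ≤ y := mul_nonneg (by linarith) (by positivity)
  let js : ℕ := ⌈y⌉₊
  have hjs1 : y ≤ js := Nat.le_ceil y
  have hjs2 : (js : ℝ) < y + 1 := Nat.ceil_lt_add_one hy0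
  have hyl : y * (ε / 4) * l = l - S cmax := by rw [hy]; field_simp
  have hθ1 : θ js * l ≤ S cmax := by
    have := mul_le_mul_of_nonneg_right hjs1 (by positivity : 0 ≤ ε / 4 * l)
    simp only [θ]; linarith
  have hθ2 : S cmax - l * (ε / 4) ≤ θ js * l := by
    have := mul_le_mul_of_nonneg_right hjs2.le (by positivity : 0 ≤ ε / 4 * l)
    simp only [θ]; linarith
  have hjsJ : js + 1 ≤ J := by
    refine Nat.succ_le_succ (Nat.ceil_mono ?_)
    rw [hy]
    refine mul_le_of_le_one_left (by positivity) ?_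
    have : 0 ≤ S cmax / l := by positivity
    linarith
  -- The decisive test: `cmax` at threshold `js`, where the mean odds are at least 1.
  let ts : ℕ := m * js + cmax
  have hdiv : ts / m = js := by
    simp only [ts]
    rw [Nat.mul_add_div hm, Nat.div_eq_of_lt cmax.2, add_zero]
  have hcon : con ts = cmax := by
    apply Fin.ext
    simp only [con, ts]
    rw [Nat.mul_add_mod, Nat.mod_eq_of_lt cmax.2]
  have hts : ts < m * (js + 1) := by
    rw [Nat.mul_succ]
    exact Nat.add_lt_add_left cmax.2 _
  have hxts : 1 ≤ x ts := by
    simp only [x]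
    rw [hdiv, hcon]
    calc (1 : ℝ) ≤ Real.exp (-(u * (θ js * l))) * Real.exp (S cmax * u) := by
          rw [← Real.exp_add]
          refine Real.one_le_exp ?_
          nlinarith [mul_le_mul_of_nonneg_left hθ1 hu0]
      _ ≤ _ := mul_le_mul_of_nonneg_left (hprod cmax) (Real.exp_pos _).le
  -- the total reward of false acceptances
  set q := Real.exp (-(u * l * (ε / 4))) with hq
  have hmq : (m : ℝ) * q ≤ 0.007 := testScale_exp_le hm hl hε hcond
  have hm1 : (1 : ℝ) ≤ m := Nat.one_le_cast.2 hm
  have hq0 : 0 < q := Real.exp_pos _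
  have hqh : q ≤ 1 / 2 := by nlinarith
  let W : ℕ → ℝ := fun t => if good (con t) then 0 else 1
  have hW0 : ∀ t, 0 ≤ W t := fun t => by simp only [W]; split_ifs <;> norm_num
  have hW1 : ∀ t, W t ≤ 1 := fun t => by simp only [W]; split_ifs <;> norm_num
  -- A bad concept is more than lε/2 below the maximum and threshold `js` at most lε/4 below it, so
  -- the gap to threshold j is at least (js + 1 - j)lε/4. The factor 1.01 covers exp(lu²/8) =
  -- exp(1/800).
  have hbad : ∀ t, t / m ≤ js → W t * x t ≤ 1.01 * q ^ (js + 1 - t / m) := by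
    intro t htj
    simp only [W]
    split_ifs with hg
    · rw [zero_mul]; positivity
    · rw [one_mul]
      have hg' : S (con t) + l * (ε / 2) < S cmax := by
        simp only [good, not_forall, not_le] at hg
        obtain ⟨c', hc'⟩ := hg
        exact hc'.trans_le (hcmax c' (Finset.mem_univ _))
      have hθj : θ (t / m) = θ js + ((js : ℝ) - (t / m : ℕ)) * (ε / 4) := by
        simp only [θ]; ring
      have h1 : ((js : ℝ) + 1 - (t / m : ℕ)) * (l * (ε / 4)) ≤ θ (t / m) * l - S (con t) := by
        rw [hθj]; linarith
      have h2 : ((js + 1 - t / m : ℕ) : ℝ) = (js : ℝ) + 1 - (t / m : ℕ) := by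
        rw [Nat.cast_sub (by omega)]; push_cast; ring
      have h3 := prod_bern_exp_le (fun i => (hp (con t) i).1) (fun i => (hp (con t) i).2) u
      rw [Fintype.card_fin] at h3
      have h4 := testScale_sq hl
      rw [← hu] at h4
      calc x t ≤ Real.exp (-(u * (θ (t / m) * l))) * Real.exp (S (con t) * u + l * (u ^ 2 / 8)) :=
            mul_le_mul_of_nonneg_left h3 (Real.exp_pos _).le
        _ = Real.exp (1 / 800) * Real.exp (-(u * (θ (t / m) * l - S (con t)))) := by
            rw [← Real.exp_add, ← Real.exp_add]
            congr 1
            linarith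
        _ ≤ 1.01 * Real.exp (-(u * (((js : ℝ) + 1 - (t / m : ℕ)) * (l * (ε / 4))))) := by
            have h8 := Real.abs_exp_sub_one_sub_id_le (x := (1 / 800 : ℝ))
              (by rw [abs_of_nonneg] <;> norm_num)
            refine mul_le_mul ?_ ?_ (Real.exp_pos _).le (by norm_num)
            · linarith [(abs_le.1 h8).2]
            · gcongr
        _ = 1.01 * q ^ (js + 1 - t / m) := by
            rw [hq, ← Real.exp_nat_mul, h2]
            ring_nf
  have hsum : ∑ s ∈ Finset.range ts, W (0 + s) * (E (0 + s) * (M * M.conjTranspose)).trace.re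
      ≤ 0.02 := by
    simp only [hM, zero_add]
    calc _ ≤ ∑ t ∈ Finset.range (m * (js + 1)), 1.01 * q ^ (js + 1 - t / m) := by
          refine (Finset.sum_le_sum fun t ht => ?_).trans
            (Finset.sum_le_sum_of_subset_of_nonneg (Finset.range_subset_range.2 hts.le)
              fun t _ _ => by positivity)
          refine (mul_le_mul_of_nonneg_left (hEx t) (hW0 t)).trans (hbad t ?_)
          rw [← hdiv]
          exact Nat.div_le_div_right (Finset.mem_range.1 ht).le
      _ = m * ∑ j ∈ Finset.range (js + 1), 1.01 * q ^ (js + 1 - j) :=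
          sum_range_mul_div hm (fun j => 1.01 * q ^ (js + 1 - j)) _
      _ ≤ m * (1.01 * (2 * q)) := by
          rw [← Finset.mul_sum]
          have := sum_pow_sub_le hq0.le hqh (js + 1)
          gcongr
      _ ≤ 0.02 := by linarith
  -- Rejection by all tests is charged in full (`w₀ := 1`); by linearity and positivity this
  -- dominates the true default reward.
  have hmain := seqEffect_trace_le hE hR (w := W) (w₀ := 1) hW0 hW1 zero_le_one le_rfl hM1
    (p := fun t => x t / (1 + x t)) (fun t => div_nonneg (hx0 t) (by linarith [hx0 t]))
    (fun t => (div_le_one (by linarith [hx0 t])).2 (by linarith)) (by norm_num) hgentle ts (m * J) 0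
    (hts.trans_le (Nat.mul_le_mul_left m hjsJ))
    (by rw [zero_add, div_le_div_iff₀ (by norm_num) (by linarith)]; linarith)
    (by
      simp only [W, zero_add, hcon]
      rw [if_pos]
      intro c'
      have := hcmax c' (Finset.mem_univ _)
      have : 0 ≤ l * (ε / 2) := by positivity
      linarith)
  refine le_trans ?_ (hmain.trans (search_bound hsum))
  rw [hM]
  have hlin : ∑ c, (if good c then (0 : ℝ) else 1) *
      (seqEffect E R (w c) (w₀ c) (m * J) 0 * productState ρ).trace.re
      = (seqEffect E R (∑ c with ¬ good c, w c) (∑ c with ¬ good c, w₀ c) (m * J) 0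
        * productState ρ).trace.re := by
    rw [seqEffect_sum, Finset.sum_mul, Matrix.trace_sum, Complex.re_sum, Finset.sum_filter]
    refine Finset.sum_congr rfl fun c _ => ?_
    by_cases hc : good c <;> simp [hc]
  have e1 : ∑ c with ¬ good c, w c = W := by
    funext t
    simp only [Finset.sum_apply, w, W]
    by_cases hc : good (con t) <;> simp [hc, Finset.sum_ite_eq]
  have e2 : ∑ c with ¬ good c, w₀ c ≤ 1 := by
    simp only [w₀]
    rw [Finset.sum_ite_eq]
    split_ifs <;> norm_num
  rw [hlin, e1]
  set v := ∑ c with ¬ good c, w₀ c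
  have hadd := seqEffect_add (E := E) (R := R) W 0 v (1 - v) (m * J) 0
  rw [add_zero, add_sub_cancel] at hadd
  rw [hadd, Matrix.add_mul, Matrix.trace_add, Complex.add_re]
  have := re_trace_mul_nonneg (seqEffect_posSemidef (R := R) (w := 0) hE (fun _ => le_rfl)
    (sub_nonneg.2 e2) (m * J) 0) hσ
  linarith

/-! ### Finite measurements with post-processed outcomes -/

open Classical in
/-- The measurement with effects `E z`, whose outcome `z` is reported as `out z`. -/
noncomputable def FinitePOVM.ofFamily {d n : ℕ} {Ω Z : Type*} [Fintype Z] (E : Z → RegOp d n)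
    (out : Z → Ω) (hE : ∀ z, (E z).PosSemidef) (hsum : ∑ z, E z = 1) : FinitePOVM d n Ω where
  outcomes := Finset.univ.image out
  effect ω := ∑ z with out z = ω, E z
  posSemidef _ _ := Matrix.posSemidef_sum _ fun z _ => hE z
  sum_effect := by
    rw [← hsum]
    exact Finset.sum_fiberwise_of_maps_to (fun z _ => Finset.mem_image_of_mem out (Finset.mem_univ z)) _

open Classical in
lemma FinitePOVM.prob_ofFamily {d n : ℕ} {Ω Z : Type*} [Fintype Z] {E : Z → RegOp d n}
    {out : Z → Ω} (hE : ∀ z, (E z).PosSemidef) (hsum : ∑ z, E z = 1) (ρ : RegOp d n) (A : Set Ω) :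
    (FinitePOVM.ofFamily E out hE hsum).prob ρ A
      = ∑ z, (if out z ∈ A then 1 else 0) * (E z * ρ).trace.re := by
  rw [FinitePOVM.prob, Finset.sum_filter]
  simp only [FinitePOVM.ofFamily]
  rw [← Finset.sum_fiberwise_of_maps_to (s := Finset.univ) (t := Finset.univ.image out) (g := out)
    (fun z _ => Finset.mem_image_of_mem out (Finset.mem_univ z))]
  refine Finset.sum_congr rfl fun ω _ => ?_
  split_ifs with h
  · rw [Finset.sum_mul, Matrix.trace_sum, Complex.re_sum]
    refine Finset.sum_congr rfl fun z hz => ?_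
    rw [(Finset.mem_filter.1 hz).2, if_pos h, one_mul]
  · refine (Finset.sum_eq_zero fun z hz => ?_).symm
    rw [(Finset.mem_filter.1 hz).2, if_neg h, zero_mul]

/-! ### Independent trials -/

open Classical in
/-- In independent trials, the probability that some trial is faulty or that all trials are
unsuccessful. -/
lemma sum_pi_fault_le {U Y : Type*} [Fintype U] [DecidableEq U] [Fintype Y] {f : U → Y → ℝ}
    (hf : ∀ r y, 0 ≤ f r y) (hf1 : ∀ r, ∑ y, f r y = 1) (faulty failed : U → Y → Prop) {η a : ℝ}
    (hη : ∀ r, ∑ y, f r y * (if faulty r y then 1 else 0) ≤ η)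
    (ha : ∀ r, ∑ y, f r y * (if failed r y then 1 else 0) ≤ a) :
    ∑ x : U → Y, (∏ r, f r (x r)) *
        (if (∃ r, faulty r (x r)) ∨ ∀ r, failed r (x r) then 1 else 0)
      ≤ Fintype.card U * η + a ^ Fintype.card U := by
  have hpos : ∀ x : U → Y, 0 ≤ ∏ r, f r (x r) := fun x => Finset.prod_nonneg fun r _ => hf r _
  have hind : ∀ x : U → Y, (if (∃ r, faulty r (x r)) ∨ ∀ r, failed r (x r) then (1 : ℝ) else 0)
      ≤ (∑ r, if faulty r (x r) then 1 else 0) + ∏ r, if failed r (x r) then 1 else 0 := by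
    intro x
    have h1 : ∀ r, (0 : ℝ) ≤ if faulty r (x r) then 1 else 0 := fun r => by split_ifs <;> norm_num
    have h2 : (0 : ℝ) ≤ ∏ r, if failed r (x r) then 1 else 0 :=
      Finset.prod_nonneg fun r _ => by split_ifs <;> norm_num
    split_ifs with h
    · rcases h with ⟨r, hr⟩ | h
      · have := Finset.single_le_sum (f := fun r => if faulty r (x r) then (1 : ℝ) else 0)
          (fun r _ => h1 r) (Finset.mem_univ r)
        simp only [hr, if_true] at this
        linarith
      · have : ∏ r, (if failed r (x r) then (1 : ℝ) else 0) = 1 :=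
          Finset.prod_eq_one fun r _ => if_pos (h r)
        have := Finset.sum_nonneg (s := Finset.univ) fun r _ => h1 r
        linarith
    · exact add_nonneg (Finset.sum_nonneg fun r _ => h1 r) h2
  calc _ ≤ ∑ x : U → Y, ((∑ r, (∏ r, f r (x r)) * (if faulty r (x r) then 1 else 0))
          + (∏ r, f r (x r)) * ∏ r, if failed r (x r) then 1 else 0) := by
        refine Finset.sum_le_sum fun x _ => ?_
        rw [← Finset.mul_sum, ← mul_add]
        exact mul_le_mul_of_nonneg_left (hind x) (hpos x)
    _ = (∑ r, ∑ x : U → Y, (∏ r, f r (x r)) * (if faulty r (x r) then 1 else 0))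
          + ∏ r, ∑ y, f r y * (if failed r y then 1 else 0) := by
        rw [Finset.sum_add_distrib, Finset.sum_comm,
          sum_pi_mul_prod f fun r y => if failed r y then 1 else 0]
    _ ≤ (∑ _r : U, η) + ∏ _r : U, a := by
        refine add_le_add (Finset.sum_le_sum fun r _ => ?_)
          (Finset.prod_le_prod (fun r _ => Finset.sum_nonneg fun y _ => mul_nonneg (hf r y)
            (by split_ifs <;> norm_num)) fun r _ => ha r)
        refine le_trans (le_of_eq ?_) (hη r)
        -- The indicator of one trial, padded with factors 1, is a product, so the other trials sum
        -- out.
        have e : ∀ x : U → Y, (if faulty r (x r) then (1 : ℝ) else 0)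
            = ∏ r', if r' = r then (if faulty r (x r') then 1 else 0) else 1 := by
          intro x
          rw [Finset.prod_ite_eq' Finset.univ r fun r' => if faulty r (x r') then (1 : ℝ) else 0,
            if_pos (Finset.mem_univ r)]
        simp_rw [e]
        rw [sum_pi_mul_prod f fun r' y => if r' = r then (if faulty r y then 1 else 0) else 1,
          Finset.prod_eq_single r]
        · simp
        · intro r' _ hr'
          simp [hr', hf1]
        · simp
    _ = _ := by simp

/-! ### Distributing the registers over blocks -/

section Blocks

open scoped Kronecker

variable {U : Type*} [Fintype U] {n l d : ℕ}

/-- The configurations of `n` registers, grouped into pairs of blocks of length `l`. -/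
def blockConfig (e : U × Bool × Fin l ≃ Fin n) :
    (Fin n → Fin d) ≃ (U → (Fin l → Fin d) × (Fin l → Fin d)) where
  toFun a r := (fun g => a (e (r, true, g)), fun g => a (e (r, false, g)))
  invFun x i := if (e.symm i).2.1 then (x (e.symm i).1).1 (e.symm i).2.2
    else (x (e.symm i).1).2 (e.symm i).2.2
  left_inv a := by
    funext i
    obtain ⟨⟨r, z, g⟩, rfl⟩ := e.surjective i
    cases z <;> simp
  right_inv x := by
    funext r
    simp

lemma productState_eq_blocks (e : U × Bool × Fin l ≃ Fin n) (ρ : Fin n → Op d) :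
    productState ρ = (tensorFamily fun r : U =>
      productState (fun g => ρ (e (r, true, g))) ⊗ₖ productState (fun g => ρ (e (r, false, g)))
      ).submatrix (blockConfig e) (blockConfig e) := by
  ext a b
  simp only [productState, tensorFamily, Matrix.of_apply, Matrix.submatrix_apply,
    Matrix.kroneckerMap_apply, blockConfig, Equiv.coe_fn_mk]
  rw [← e.prod_comp, Fintype.prod_prod_type]
  refine Finset.prod_congr rfl fun r _ => ?_
  rw [Fintype.prod_prod_type, Fintype.prod_bool]

lemma trace_submatrix_equiv {ν ν' : Type*} [Fintype ν] [Fintype ν'] (e : ν ≃ ν')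
    (A : Matrix ν' ν' ℂ) : (A.submatrix e e).trace = A.trace := by
  simp only [Matrix.trace, Matrix.diag, Matrix.submatrix_apply]
  exact e.sum_comp fun i => A i i

variable [DecidableEq U]

/-- Product effects on a product state: the pairs are independent trials, and within a pair so are
the two blocks. -/
lemma trace_blocks_mul (e : U × Bool × Fin l ≃ Fin n) {ρ : Fin n → Op d}
    (hρ : ∀ i, IsDensity (ρ i)) {F V : U → RegOp d l} (hF : ∀ r, (F r).PosSemidef)
    (hV : ∀ r, (V r).PosSemidef) :
    ((tensorFamily fun r => F r ⊗ₖ V r).submatrix (blockConfig e) (blockConfig e)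
        * productState ρ).trace.re
      = ∏ r, (F r * productState fun g => ρ (e (r, true, g))).trace.re
          * (V r * productState fun g => ρ (e (r, false, g))).trace.re := by
  have hpos : ∀ r z, (productState fun g => ρ (e (r, z, g))).PosSemidef := fun r z =>
    tensorFamily_posSemidef fun g => (hρ _).1
  rw [productState_eq_blocks e ρ, Matrix.submatrix_mul_equiv, trace_submatrix_equiv,
    tensorFamily_trace_mul_re (fun r => (hF r).kronecker (hV r))
      fun r => (hpos r true).kronecker (hpos r false)]
  refine Finset.prod_congr rfl fun r _ => ?_
  rw [← Matrix.mul_kronecker_mul, Matrix.trace_kronecker, trace_mul_eq_re (hF r) (hpos r true),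
    trace_mul_eq_re (hV r) (hpos r false), ← Complex.ofReal_mul]
  simp only [Complex.ofReal_re]

lemma sum_blocks_eq_one (e : U × Bool × Fin l ≃ Fin n) {Y : Type*} [Fintype Y]
    (A : U → Y → Matrix ((Fin l → Fin d) × (Fin l → Fin d)) ((Fin l → Fin d) × (Fin l → Fin d)) ℂ)
    (hA : ∀ r, ∑ y, A r y = 1) :
    ∑ x : U → Y, (tensorFamily fun r => A r (x r)).submatrix (blockConfig e) (blockConfig e)
      = (1 : RegOp d n) := by
  have h := tensorFamily_sum A
  simp only [hA, tensorFamily_one] at h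
  rw [← Matrix.submatrix_one_equiv (blockConfig e), ← h]
  ext a b
  simp [Matrix.sum_apply]

/-- The distribution of registers over the blocks: register `(a, g)` of group `g` is put into the
block `a - s g`. -/
def shiftBlocks {G : Type*} [AddCommGroup G] (e₀ : G × Fin l ≃ Fin n) (β : U × Bool ≃ G)
    (s : Fin l → G) : U × Bool × Fin l ≃ Fin n where
  toFun y := e₀ (β (y.1, y.2.1) + s y.2.2, y.2.2)
  invFun i := ((β.symm ((e₀.symm i).1 - s (e₀.symm i).2)).1,
    (β.symm ((e₀.symm i).1 - s (e₀.symm i).2)).2, (e₀.symm i).2)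
  left_inv y := by simp
  right_inv i := by simp

open Classical in
/-- Under random shifts, each block is a representative sample. -/
lemma shift_deviation {G : Type*} [AddCommGroup G] [Fintype G]
    (e₀ : G × Fin l ≃ Fin n) (β : U × Bool ≃ G) {p : Fin n → ℝ} (h0 : ∀ i, 0 ≤ p i)
    (h1 : ∀ i, p i ≤ 1) {t : ℝ} (ht : 0 ≤ t) (r : U) (z : Bool) :
    ∑ s : Fin l → G, (∏ _g : Fin l, (Fintype.card G : ℝ)⁻¹) *
        (if (l : ℝ) * t ≤ |∑ g, p (shiftBlocks e₀ β s (r, z, g))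
          - (Fintype.card G : ℝ)⁻¹ * ∑ i, p i| then 1 else 0)
      ≤ 2 * Real.exp (-(2 * (l : ℝ) * t ^ 2)) := by
  have hG : (Fintype.card G : ℝ) ≠ 0 := Nat.cast_ne_zero.2 Fintype.card_ne_zero
  -- Within a fixed block, the register from group `g` is uniform over that group, independently for
  -- different `g`.
  have := hoeffding_two_sided (ι := Fin l) (α := G) (q := fun _ _ => (Fintype.card G : ℝ)⁻¹)
    (Y := fun g a => p (e₀ (β (r, z) + a, g))) (fun _ _ => by positivity)
    (fun _ => by simp [hG]) (fun _ _ => h0 _) (fun _ _ => h1 _) ht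
  have hmean : ∀ g, ∑ a, (Fintype.card G : ℝ)⁻¹ * p (e₀ (β (r, z) + a, g))
      = (Fintype.card G : ℝ)⁻¹ * ∑ a, p (e₀ (a, g)) := fun g => by
    rw [← Finset.mul_sum, ← Equiv.sum_comp (Equiv.addLeft (β (r, z))) fun a => p (e₀ (a, g))]
    rfl
  have htot : ∑ g, ∑ a, p (e₀ (a, g)) = ∑ i, p i := by
    rw [← e₀.sum_comp, Fintype.sum_prod_type_right]
  simp only [hmean, Finset.sum_sub_distrib, ← Finset.mul_sum, htot, Fintype.card_fin] at this
  rw [Finset.mul_sum] at this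
  convert this
  rfl

end Blocks

/-! ### The measurement of the learner -/

/-- The mean value of a list of projectors on a list of states. -/
noncomputable def meanValue {d n : ℕ} (ρ P : Fin n → Op d) : ℝ :=
  (1 / (n : ℝ)) * ∑ i, ((ρ i * P i).trace).re

open scoped Kronecker in
open Classical in
/-- A measurement that finds a concept of nearly maximal mean value, together with an estimate. -/
theorem exists_measurement {d m l N : ℕ} (hm : 0 < m) (hl : 0 < l) (hN : 0 < N) {ε : ℝ}
    (hε : 0 < ε) (hcond : (Real.log m + 5) ^ 2 ≤ 1 / 1600 * (l : ℝ) * ε ^ 2)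
    {n : ℕ} (hn : n = 2 * N * l) {P : Fin m → Fin n → Op d}
    (hP : ∀ c i, IsStarProjection (P c i)) :
    ∃ A : FinitePOVM d n (Fin m × ℝ), ∀ ρ : Fin n → Op d, (∀ i, IsDensity (ρ i)) →
      A.prob (productState ρ) {ω | ¬ (|ω.2 - meanValue ρ (P ω.1)| ≤ ε ∧
          ∀ c, meanValue ρ (P c) ≤ ω.2 + 3 / 2 * ε)}
        ≤ (3 / 4) ^ N + N * (2 * Real.exp (-(l * ε ^ 2 / 8)))
          + m * (2 * N) * (2 * Real.exp (-(l * ε ^ 2 / 8))) := by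
  have : NeZero (2 * N) := ⟨by omega⟩
  have : NeZero N := ⟨by omega⟩
  let G := ZMod (2 * N)
  have hG : Fintype.card G = 2 * N := ZMod.card _
  let e₀ : G × Fin l ≃ Fin n := Fintype.equivOfCardEq (by
    rw [Fintype.card_prod, hG, Fintype.card_fin, Fintype.card_fin, hn])
  let β : Fin N × Bool ≃ G := Fintype.equivOfCardEq (by
    rw [Fintype.card_prod, hG, Fintype.card_fin, Fintype.card_bool, mul_comm])
  let e : (Fin l → G) → Fin N × Bool × Fin l ≃ Fin n := fun s => shiftBlocks e₀ β s
  choose F hF hF1 hFs using fun (s : Fin l → G) (r : Fin N) =>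
    exists_search_measurement hm hl hε hcond (P := fun c g => P c (e s (r, true, g)))
      fun c g => hP c _
  let V : (Fin l → G) → Fin N → Fin m → (Fin l → Bool) → RegOp d l := fun s r c =>
    jointPVM fun g => P c (e s (r, false, g))
  have hV : ∀ s r c, IsPVM (V s r c) := fun s r c => jointPVM_isPVM fun g => hP c _
  let Y := Fin m × (Fin l → Bool)
  -- Block `true` of a pair is searched; on block `false` the concept found there is measured.
  let A : (Fin l → G) → Fin N → Y → Matrix ((Fin l → Fin d) × (Fin l → Fin d))
      ((Fin l → Fin d) × (Fin l → Fin d)) ℂ := fun s r y => F s r y.1 ⊗ₖ V s r y.1 y.2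
  have hA1 : ∀ s r, ∑ y, A s r y = 1 := by
    intro s r
    have h : ∀ c, ∑ b, F s r c ⊗ₖ V s r c b = F s r c ⊗ₖ (1 : RegOp d l) := by
      intro c
      rw [← (hV s r c).sum]
      ext i j
      simp [Matrix.sum_apply, Finset.mul_sum]
    rw [Fintype.sum_prod_type]
    simp only [A, h]
    rw [← Matrix.one_kronecker_one, ← hF1 s r]
    ext i j
    simp [Matrix.sum_apply, Finset.sum_mul]
  let wt : ℝ := ∏ _g : Fin l, (Fintype.card G : ℝ)⁻¹
  have hwt : 0 ≤ wt := Finset.prod_nonneg fun _ _ => by positivity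
  have hwt1 : ∑ _s : Fin l → G, wt = 1 :=
    sum_pi_weight (ι := Fin l) (α := G) (q := fun _ _ => (Fintype.card G : ℝ)⁻¹) fun _ => by
      simp [Fintype.card_ne_zero]
  -- The random shift is made part of the outcome, its uniform weight being absorbed into the
  -- effect.
  let Eff : (Fin l → G) × (Fin N → Y) → RegOp d n := fun z => (wt : ℂ) •
    (tensorFamily fun r => A z.1 r (z.2 r)).submatrix (blockConfig (e z.1)) (blockConfig (e z.1))
  have hEff : ∀ z, (Eff z).PosSemidef := fun z =>
    posSemidef_real_smul ((tensorFamily_posSemidef fun r =>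
      (hF z.1 r _).kronecker ((hV z.1 r _).posSemidef _)).submatrix _) hwt
  have hEff1 : ∑ z, Eff z = 1 := by
    rw [Fintype.sum_prod_type]
    have h : ∀ s, ∑ x, Eff (s, x) = (wt : ℂ) • (1 : RegOp d n) := fun s => by
      rw [← sum_blocks_eq_one (e s) (A s) (hA1 s), Finset.smul_sum]
    simp only [h]
    rw [← Finset.sum_smul, ← Complex.ofReal_sum, hwt1, Complex.ofReal_one, one_smul]
  choose best hbest using fun x : Fin N → Y => Finite.exists_max fun r => count (x r).2 / (l : ℝ)
  let out : (Fin l → G) × (Fin N → Y) → Fin m × ℝ := fun z =>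
    ((z.2 (best z.2)).1, count (z.2 (best z.2)).2 / (l : ℝ))
  refine ⟨FinitePOVM.ofFamily Eff out hEff hEff1, fun ρ hρ => ?_⟩
  obtain ⟨bad, hbad⟩ : ∃ bad : Set (Fin m × ℝ), bad = {ω | ¬ (|ω.2 - meanValue ρ (P ω.1)| ≤ ε ∧
    ∀ c, meanValue ρ (P c) ≤ ω.2 + 3 / 2 * ε)} := ⟨_, rfl⟩
  rw [← hbad, FinitePOVM.prob_ofFamily, Fintype.sum_prod_type]
  let p : Fin m → Fin n → ℝ := fun c i => (ρ i * P c i).trace.re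
  have hp : ∀ c i, 0 ≤ p c i ∧ p c i ≤ 1 := fun c i =>
    trace_projection_mem_Icc (hP c i) (hρ i).1 (hρ i).2
  let f : (Fin l → G) → Fin N → Y → ℝ := fun s r y =>
    (F s r y.1 * productState fun g => ρ (e s (r, true, g))).trace.re
      * (V s r y.1 y.2 * productState fun g => ρ (e s (r, false, g))).trace.re
  have hpos : ∀ s r z, (productState fun g => ρ (e s (r, z, g))).PosSemidef := fun s r z =>
    tensorFamily_posSemidef fun g => (hρ _).1
  have htr : ∀ s r z, (productState fun g => ρ (e s (r, z, g))).trace.re = 1 := by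
    intro s r z
    change (tensorFamily _).trace.re = 1
    rw [tensorFamily_trace]
    simp [(hρ _).2]
  have hF0 : ∀ s r c, 0 ≤ (F s r c * productState fun g => ρ (e s (r, true, g))).trace.re :=
    fun s r c => re_trace_mul_nonneg (hF s r c) (hpos s r true)
  have hFsum : ∀ s r, ∑ c, (F s r c * productState fun g => ρ (e s (r, true, g))).trace.re = 1 := by
    intro s r
    rw [← Complex.re_sum, ← Matrix.trace_sum, ← Finset.sum_mul, hF1, Matrix.one_mul, htr]
  have hVtr : ∀ s r c b, (V s r c b * productState fun g => ρ (e s (r, false, g))).trace.re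
      = ∏ g, bern (p c (e s (r, false, g))) (b g) := fun s r c b =>
    jointPVM_trace (fun g => hP c _) (fun g => (hρ _).1) (fun g => (hρ _).2) b
  have hVsum : ∀ s r c, ∑ b, (V s r c b * productState fun g => ρ (e s (r, false, g))).trace.re
      = 1 := by
    intro s r c
    simp only [hVtr]
    exact sum_pi_weight fun g => sum_bern _
  have hf0 : ∀ s r y, 0 ≤ f s r y := fun s r y =>
    mul_nonneg (hF0 s r _) (re_trace_mul_nonneg ((hV s r _).posSemidef _) (hpos s r false))
  have hf1 : ∀ s r, ∑ y, f s r y = 1 := by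
    intro s r
    rw [Fintype.sum_prod_type]
    simp only [f, ← Finset.mul_sum, hVsum, mul_one, hFsum]
  have hEfft : ∀ s x, (Eff (s, x) * productState ρ).trace.re = wt * ∏ r, f s r (x r) := by
    intro s x
    simp only [Eff, A, f]
    rw [Matrix.smul_mul, Matrix.trace_smul, smul_eq_mul, Complex.re_ofReal_mul,
      trace_blocks_mul (e s) hρ (fun r => hF s r _) fun r => (hV s r _).posSemidef _]
  -- the deviations of the block values from the mean values
  let dev : (Fin l → G) → Fin m → Fin N × Bool → Prop := fun s c rz =>
    (l : ℝ) * (ε / 4) ≤ |∑ g, p c (e s (rz.1, rz.2, g)) - (Fintype.card G : ℝ)⁻¹ * ∑ i, p c i|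
  set η : ℝ := 2 * Real.exp (-(l * ε ^ 2 / 8)) with hη
  have hη' : 2 * Real.exp (-(2 * (l : ℝ) * (ε / 4) ^ 2)) = η := by rw [hη]; ring_nf
  have hdev : ∀ c rz, ∑ s : Fin l → G, wt * (if dev s c rz then 1 else 0) ≤ η := by
    intro c rz
    rw [← hη']
    exact shift_deviation e₀ β (fun i => (hp c i).1) (fun i => (hp c i).2) (by positivity) rz.1 rz.2
  let faulty : (Fin l → G) → Fin N → Y → Prop := fun s r y =>
    (l : ℝ) * (ε / 4) ≤ |count y.2 - ∑ g, p y.1 (e s (r, false, g))|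
  let failed : (Fin l → G) → Fin N → Y → Prop := fun s r y =>
    ¬ ∀ c', ∑ g, p c' (e s (r, true, g)) ≤ ∑ g, p y.1 (e s (r, true, g)) + l * (ε / 2)
  have hfaulty : ∀ s r, ∑ y, f s r y * (if faulty s r y then 1 else 0) ≤ η := by
    intro s r
    rw [Fintype.sum_prod_type]
    calc _ ≤ ∑ c, (F s r c * productState fun g => ρ (e s (r, true, g))).trace.re * η := by
          refine Finset.sum_le_sum fun c _ => ?_
          simp only [f, mul_assoc, ← Finset.mul_sum]
          refine mul_le_mul_of_nonneg_left ?_ (hF0 s r c)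
          simp only [hVtr, faulty]
          have := count_deviation (p := fun g => p c (e s (r, false, g))) (fun g => (hp c _).1)
            (fun g => (hp c _).2) (t := ε / 4) (by positivity)
          rwa [Fintype.card_fin, hη'] at this
      _ = η := by rw [← Finset.sum_mul, hFsum, one_mul]
  have hfailed : ∀ s r, ∑ y, f s r y * (if failed s r y then 1 else 0) ≤ 3 / 4 := by
    intro s r
    refine le_trans (le_of_eq ?_) (hFs s r (fun g => ρ (e s (r, true, g))) fun g => hρ _)
    rw [Fintype.sum_prod_type]
    refine Finset.sum_congr rfl fun c _ => ?_
    simp only [f, failed, ite_not]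
    rw [← Finset.sum_mul, ← Finset.mul_sum, hVsum, mul_one, mul_comm]
  have hlpos : (0 : ℝ) < l := Nat.cast_pos.2 hl
  have hmean : ∀ c, (Fintype.card G : ℝ)⁻¹ * ∑ i, p c i = l * meanValue ρ (P c) := by
    intro c
    have hn' : (n : ℝ) = 2 * N * l := by rw [hn]; push_cast; ring
    have hN' : (0 : ℝ) < N := Nat.cast_pos.2 hN
    rw [meanValue, hG, hn']
    push_cast
    field_simp
    rfl
  -- Counting and block deviation cost ε/4 each, so every estimate is ε/2-accurate. At a successful
  -- pair the optimum is missed by ε/2 (search) + 2·ε/4 (deviations) + ε/2 (estimate) = 3ε/2, and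
  -- the largest estimate does no worse.
  have hout : ∀ s x, (¬ ∃ c rz, dev s c rz) → out (s, x) ∈ bad →
      (∃ r, faulty s r (x r)) ∨ ∀ r, failed s r (x r) := by
    intro s x hs hb
    by_contra hcon
    obtain ⟨hfa', hr⟩ := not_or.1 hcon
    obtain ⟨r₀, hr₀'⟩ := not_forall.1 hr
    have hr₀ : ∀ c', ∑ g, p c' (e s (r₀, true, g))
        ≤ ∑ g, p (x r₀).1 (e s (r₀, true, g)) + l * (ε / 2) := not_not.1 hr₀'
    have hfa : ∀ r, |count (x r).2 - ∑ g, p (x r).1 (e s (r, false, g))| < l * (ε / 4) :=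
      fun r => not_le.1 fun h => hfa' ⟨r, h⟩
    have hdv : ∀ c r z, |∑ g, p c (e s (r, z, g)) - l * meanValue ρ (P c)| < l * (ε / 4) :=
      fun c r z => by
        rw [← hmean]
        exact not_le.1 fun h => hs ⟨c, (r, z), h⟩
    rw [hbad] at hb
    refine hb ?_
    have hest : ∀ r, |count (x r).2 / (l : ℝ) - meanValue ρ (P (x r).1)| < ε / 2 := by
      intro r
      have h1 := abs_lt.1 (hfa r)
      have h2 := abs_lt.1 (hdv (x r).1 r false)
      have e1 : count (x r).2 / (l : ℝ) - meanValue ρ (P (x r).1)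
          = (count (x r).2 - l * meanValue ρ (P (x r).1)) / l := by field_simp
      rw [e1, abs_div, abs_of_pos hlpos, div_lt_iff₀ hlpos, abs_lt]
      constructor <;> linarith [h1.1, h1.2, h2.1, h2.2]
    refine ⟨(hest _).le.trans (by linarith), fun c => ?_⟩
    have h1 := abs_lt.1 (hdv c r₀ true)
    have h2 := abs_lt.1 (hdv (x r₀).1 r₀ true)
    have h3 := hr₀ c
    have h4 : (l : ℝ) * meanValue ρ (P c) ≤ l * (meanValue ρ (P (x r₀).1) + ε) := by
      linarith [h1.1, h2.2]
    have h5 := le_of_mul_le_mul_left h4 hlpos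
    have h6 := abs_lt.1 (hest r₀)
    have h7 := hbest x r₀
    change _ ≤ count (x (best x)).2 / (l : ℝ) + _
    linarith [h6.1]
  -- the error probability for a given shift
  have hinner : ∀ s, ∑ x, (if out (s, x) ∈ bad then 1 else 0) * (Eff (s, x) * productState ρ).trace.re
      ≤ wt * ((3 / 4) ^ N + N * η) + ∑ c, ∑ rz, wt * (if dev s c rz then 1 else 0) := by
    intro s
    have hind : ∀ c rz, 0 ≤ wt * (if dev s c rz then (1 : ℝ) else 0) := fun c rz =>
      mul_nonneg hwt (by split_ifs <;> norm_num)
    have hfx : ∀ x : Fin N → Y, 0 ≤ ∏ r, f s r (x r) := fun x =>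
      Finset.prod_nonneg fun r _ => hf0 s r _
    have hη0 : 0 ≤ η := by positivity
    have e1 : ∑ x, (if out (s, x) ∈ bad then 1 else 0) * (Eff (s, x) * productState ρ).trace.re
        = wt * ∑ x, (∏ r, f s r (x r)) * (if out (s, x) ∈ bad then 1 else 0) := by
      rw [Finset.mul_sum]
      refine Finset.sum_congr rfl fun x _ => ?_
      rw [hEfft]; ring
    rw [e1]
    by_cases hs : ∃ c rz, dev s c rz
    · obtain ⟨c, rz, h⟩ := hs
      have h1 : wt ≤ ∑ c, ∑ rz, wt * (if dev s c rz then (1 : ℝ) else 0) := by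
        calc wt = wt * (if dev s c rz then (1 : ℝ) else 0) := by rw [if_pos h, mul_one]
          _ ≤ ∑ rz, wt * (if dev s c rz then (1 : ℝ) else 0) :=
            Finset.single_le_sum (f := fun rz => wt * (if dev s c rz then (1 : ℝ) else 0))
              (fun rz _ => hind c rz) (Finset.mem_univ rz)
          _ ≤ _ := Finset.single_le_sum
              (f := fun c => ∑ rz, wt * (if dev s c rz then (1 : ℝ) else 0))
              (fun c _ => Finset.sum_nonneg fun rz _ => hind c rz) (Finset.mem_univ c)
      have h2 : ∑ x, (∏ r, f s r (x r)) * (if out (s, x) ∈ bad then (1 : ℝ) else 0) ≤ 1 := by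
        refine (Finset.sum_le_sum fun x _ => mul_le_of_le_one_right (hfx x) ?_).trans
          (sum_pi_weight (hf1 s)).le
        split_ifs <;> norm_num
      have h3 := mul_le_mul_of_nonneg_left h2 hwt
      have h4 : 0 ≤ wt * ((3 / 4) ^ N + N * η) := by positivity
      linarith
    · refine le_add_of_le_of_nonneg (mul_le_mul_of_nonneg_left ?_ hwt)
        (Finset.sum_nonneg fun c _ => Finset.sum_nonneg fun rz _ => hind c rz)
      have h := sum_pi_fault_le (hf0 s) (hf1 s) (faulty s) (failed s) (hfaulty s)
        (fun r => by convert hfailed s r)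
      rw [Fintype.card_fin, add_comm] at h
      refine le_trans (Finset.sum_le_sum fun x _ => mul_le_mul_of_nonneg_left ?_ (hfx x)) h
      split_ifs with h1 h2 h2
      · exact le_rfl
      · exact absurd (hout s x hs h1) h2
      · exact zero_le_one
      · exact le_rfl
  calc _ ≤ ∑ s, (wt * ((3 / 4) ^ N + N * η)
          + ∑ c, ∑ rz, wt * (if dev s c rz then 1 else 0)) := Finset.sum_le_sum fun s _ => hinner s
    _ = (3 / 4) ^ N + N * η + ∑ c, ∑ rz, ∑ s, wt * (if dev s c rz then 1 else 0) := by
        rw [Finset.sum_add_distrib, ← Finset.sum_mul, hwt1, one_mul, Finset.sum_comm]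
        congr 1
        exact Finset.sum_congr rfl fun c _ => Finset.sum_comm
    _ ≤ (3 / 4) ^ N + N * η + ∑ _c : Fin m, ∑ _rz : Fin N × Bool, η := by
        gcongr with c _ rz _
        exact hdev c rz
    _ = _ := by
        simp
        ring

/-! ### Comparison of values -/

/-- With ρ = BᴴB the trace is ∑ⱼ ⟨vⱼ, A vⱼ⟩ over the conjugated rows vⱼ of B, whose squared norms
sum to Tr ρ = 1. -/
lemma abs_trace_mul_le_opNorm {d : ℕ} {ρ : Op d} (hρ : IsDensity ρ) (A : Op d) :
    |(ρ * A).trace.re| ≤ opNorm A := by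
  obtain ⟨B, hB⟩ := exists_eq_conjTranspose_mul_self hρ.1
  let v : Fin d → EuclideanSpace ℂ (Fin d) := fun j => WithLp.toLp 2 fun k => star (B j k)
  have h1 : (ρ * A).trace = ∑ j, inner ℂ (v j) (Matrix.toEuclideanCLM (n := Fin d) (𝕜 := ℂ) A (v j)) := by
    rw [hB, Matrix.mul_assoc, Matrix.trace_mul_comm, Matrix.trace]
    refine Finset.sum_congr rfl fun j _ => ?_
    rw [EuclideanSpace.inner_eq_star_dotProduct, Matrix.ofLp_toEuclideanCLM, Matrix.diag,
      Matrix.mul_assoc, Matrix.mul_apply, dotProduct_comm]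
    refine Finset.sum_congr rfl fun k _ => ?_
    simp [v, Matrix.mul_apply, Matrix.mulVec, dotProduct]
  have h2 : ∑ j, ‖v j‖ ^ 2 = 1 := by
    have : ((∑ j, ‖v j‖ ^ 2 : ℝ) : ℂ) = ρ.trace := by
      rw [hB, Matrix.trace_mul_comm, Matrix.trace, Complex.ofReal_sum]
      refine Finset.sum_congr rfl fun j _ => ?_
      rw [EuclideanSpace.norm_sq_eq, Matrix.diag, Matrix.mul_apply, Complex.ofReal_sum]
      refine Finset.sum_congr rfl fun k _ => ?_
      rw [Matrix.conjTranspose_apply, Complex.star_def, Complex.mul_conj, Complex.normSq_eq_norm_sq]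
      simp [v]
    rw [hρ.2] at this
    exact_mod_cast this
  rw [h1]
  calc _ ≤ ‖∑ j, inner ℂ (v j) (Matrix.toEuclideanCLM (n := Fin d) (𝕜 := ℂ) A (v j))‖ :=
        Complex.abs_re_le_norm _
    _ ≤ ∑ j, opNorm A * ‖v j‖ ^ 2 := by
        refine norm_sum_le_of_le _ fun j _ => (norm_inner_le_norm _ _).trans ?_
        have := (Matrix.toEuclideanCLM (n := Fin d) (𝕜 := ℂ) A).le_opNorm (v j)
        have h3 := mul_le_mul_of_nonneg_left this (norm_nonneg (v j))
        rw [opNorm]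
        nlinarith
    _ = opNorm A := by rw [← Finset.mul_sum, h2, mul_one]

lemma abs_meanValue_sub_le {X : Type*} {d n : ℕ} {ρ : X → Op d} (hρ : ∀ x, IsDensity (ρ x))
    (x : Fin n → X) (f g : X → Op d) :
    |meanValue (fun i => ρ (x i)) (fun i => f (x i)) - meanValue (fun i => ρ (x i)) fun i => g (x i)|
      ≤ seminormOneInf x (f - g) := by
  rw [meanValue, meanValue, ← mul_sub, ← Finset.sum_sub_distrib, abs_mul, seminormOneInf,
    abs_of_nonneg (by positivity : 0 ≤ 1 / (n : ℝ))]
  refine mul_le_mul_of_nonneg_left ((Finset.abs_sum_le_sum_abs _ _).trans ?_) (by positivity)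
  refine Finset.sum_le_sum fun i _ => ?_
  have := abs_trace_mul_le_opNorm (hρ (x i)) ((f - g) (x i))
  rwa [Pi.sub_apply, Matrix.mul_sub, Matrix.trace_sub, Complex.sub_re] at this

/-- With mean m, Jensen from below and Hoeffding's lemma from above put γ times the tilted value in
[γm, γm + γ²/8]. -/
lemma abs_tiltedValue_sub_meanValue_le {d n : ℕ} (hn : 0 < n) {γ : ℝ} (hγ : γ ≠ 0)
    {ρ P : Fin n → Op d} (hρ : ∀ i, IsDensity (ρ i)) (hP : ∀ i, IsStarProjection (P i)) :
    |tiltedValue γ ρ P - meanValue ρ P| ≤ |γ| / 8 := by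
  have hn' : (0 : ℝ) < n := Nat.cast_pos.2 hn
  have hp : ∀ i, 0 ≤ (ρ i * P i).trace.re ∧ (ρ i * P i).trace.re ≤ 1 := fun i =>
    trace_projection_mem_Icc (hP i) (hρ i).1 (hρ i).2
  have hq1 : ∑ _i : Fin n, 1 / (n : ℝ) = 1 := by simp [hn'.ne']
  have hup := sum_mul_exp_le (q := fun _ : Fin n => 1 / (n : ℝ)) (fun _ => by positivity) hq1
    (fun i => (hp i).1) (fun i => (hp i).2) γ
  simp only [← Finset.mul_sum] at hup
  set m := meanValue ρ P with hm
  rw [show (1 / (n : ℝ)) * ∑ i, (ρ i * P i).trace.re = m from rfl] at hup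
  set L := (1 / (n : ℝ)) * ∑ i, Real.exp (γ * (ρ i * P i).trace.re) with hL
  have hlow : Real.exp (m * γ) ≤ L := by
    have h1 : ∀ i, Real.exp (m * γ) * (1 + γ * (ρ i * P i).trace.re - m * γ)
        ≤ Real.exp (γ * (ρ i * P i).trace.re) := by
      intro i
      have h := Real.add_one_le_exp (γ * (ρ i * P i).trace.re - m * γ)
      calc _ ≤ Real.exp (m * γ) * Real.exp (γ * (ρ i * P i).trace.re - m * γ) :=
            mul_le_mul_of_nonneg_left (by linarith) (Real.exp_pos _).le
        _ = _ := by rw [← Real.exp_add]; ring_nf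
    calc Real.exp (m * γ)
        = (1 / (n : ℝ)) * ∑ i, Real.exp (m * γ) * (1 + γ * (ρ i * P i).trace.re - m * γ) := by
          rw [← Finset.mul_sum, Finset.sum_sub_distrib, Finset.sum_add_distrib, ← Finset.mul_sum]
          have : ∑ i, (ρ i * P i).trace.re = n * m := by
            rw [hm, meanValue]; field_simp
          rw [this]
          simp
          field_simp
          ring
      _ ≤ L := mul_le_mul_of_nonneg_left (Finset.sum_le_sum fun i _ => h1 i) (by positivity)
  have hLpos : 0 < L := (Real.exp_pos _).trans_le hlow
  have h1 : m * γ ≤ Real.log L := (Real.le_log_iff_exp_le hLpos).2 hlow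
  have h2 : Real.log L ≤ m * γ + γ ^ 2 / 8 := (Real.log_le_iff_le_exp hLpos).2 hup
  have e : tiltedValue γ ρ P - m = (Real.log L - m * γ) / γ := by
    rw [tiltedValue, ← hL]
    field_simp
  rw [e, abs_div, abs_of_nonneg (by linarith), div_le_iff₀ (abs_pos.2 hγ)]
  rw [div_mul_eq_mul_div, ← sq, sq_abs]
  linarith

lemma meanValue_mem_Icc {d n : ℕ} {ρ P : Fin n → Op d} (hρ : ∀ i, IsDensity (ρ i))
    (hP : ∀ i, IsStarProjection (P i)) : 0 ≤ meanValue ρ P ∧ meanValue ρ P ≤ 1 := by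
  have hp : ∀ i, 0 ≤ (ρ i * P i).trace.re ∧ (ρ i * P i).trace.re ≤ 1 := fun i =>
    trace_projection_mem_Icc (hP i) (hρ i).1 (hρ i).2
  refine ⟨mul_nonneg (by positivity) (Finset.sum_nonneg fun i _ => (hp i).1), ?_⟩
  have h : ∑ i, (ρ i * P i).trace.re ≤ n := by
    simpa using Finset.sum_le_sum fun i (_ : i ∈ Finset.univ) => (hp i).2
  rw [meanValue, one_div, inv_mul_eq_div]
  exact div_le_one_of_le₀ h (by positivity)

lemma meanValue_one_sub {d n : ℕ} (hn : 0 < n) {ρ : Fin n → Op d} (hρ : ∀ i, IsDensity (ρ i))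
    (P : Fin n → Op d) : meanValue ρ (fun i => 1 - P i) = 1 - meanValue ρ P := by
  have hn' : (n : ℝ) ≠ 0 := Nat.cast_ne_zero.2 hn.ne'
  simp only [meanValue, Matrix.mul_sub, Matrix.mul_one, Matrix.trace_sub, (hρ _).2, Complex.sub_re,
    Complex.one_re, Finset.sum_sub_distrib, mul_sub]
  simp [hn']

/-! ### Measurements for both optimization problems -/

open Classical in
lemma FinitePOVM.prob_mono {d n : ℕ} {Ω : Type*} (A : FinitePOVM d n Ω) {ρ : RegOp d n}
    (hρ : ρ.PosSemidef) {E E' : Set Ω} (h : E ⊆ E') : A.prob ρ E ≤ A.prob ρ E' :=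
  Finset.sum_le_sum_of_subset_of_nonneg
    (fun ω hω => by
      rw [Finset.mem_filter] at hω ⊢
      exact ⟨hω.1, h hω.2⟩)
    fun ω hω _ => re_trace_mul_nonneg (A.posSemidef ω (Finset.mem_filter.1 hω).1) hρ

lemma FinitePOVM.exists_map {d n : ℕ} {Ω Ω' : Type*} (A : FinitePOVM d n Ω) (φ : Ω → Ω') :
    ∃ A' : FinitePOVM d n Ω', ∀ ρ E, A'.prob ρ E = A.prob ρ (φ ⁻¹' E) := by
  classical
  refine ⟨FinitePOVM.ofFamily (fun z : A.outcomes => A.effect z) (fun z => φ z)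
    (fun z => A.posSemidef z z.2) ?_, fun ρ E => ?_⟩
  · rw [Finset.sum_coe_sort A.outcomes A.effect]
    exact A.sum_effect
  · rw [FinitePOVM.prob_ofFamily, FinitePOVM.prob, Finset.sum_filter,
      Finset.sum_coe_sort A.outcomes
        fun z => (if φ z ∈ E then (1 : ℝ) else 0) * (A.effect z * ρ).trace.re]
    refine Finset.sum_congr rfl fun z _ => ?_
    rw [ite_mul, one_mul, zero_mul]
    rfl

/-- The measurement with the single outcome `ω`. -/
lemma FinitePOVM.exists_const (d n : ℕ) {Ω : Type*} (ω : Ω) :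
    ∃ A : FinitePOVM d n Ω, ∀ ρ E, ω ∉ E → A.prob ρ E = 0 := by
  refine ⟨FinitePOVM.ofFamily (fun _ : Unit => 1) (fun _ => ω) (fun _ => Matrix.PosSemidef.one)
    (by simp), fun ρ E hω => ?_⟩
  rw [FinitePOVM.prob_ofFamily]
  simp [hω]

/-- The outcome `ω` is accurate: the estimate is close to the mean value of the selected
concept and, up to `3ε/2`, not exceeded by any mean value (`s = 1`) or not larger than any mean value
(`s = -1`). -/
def IsAccurate {d m n : ℕ} (s ε : ℝ) (ρ : Fin n → Op d) (P : Fin m → Fin n → Op d)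
    (ω : Fin m × ℝ) : Prop :=
  |ω.2 - meanValue ρ (P ω.1)| ≤ ε ∧ ∀ c, s * (meanValue ρ (P c) - ω.2) ≤ 3 / 2 * ε

theorem exists_accurate_measurement {d m l N : ℕ} (hm : 0 < m) (hl : 0 < l) (hN : 0 < N) {s : ℝ}
    (hs : s = 1 ∨ s = -1) {ε : ℝ} (hε : 0 < ε)
    (hcond : (Real.log m + 5) ^ 2 ≤ 1 / 1600 * (l : ℝ) * ε ^ 2)
    {n : ℕ} (hn : n = 2 * N * l) {P : Fin m → Fin n → Op d}
    (hP : ∀ c i, IsStarProjection (P c i)) :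
    ∃ A : FinitePOVM d n (Fin m × ℝ), ∀ ρ : Fin n → Op d, (∀ i, IsDensity (ρ i)) →
      A.prob (productState ρ) {ω | ¬ IsAccurate s ε ρ P ω}
        ≤ (3 / 4) ^ N + N * (2 * Real.exp (-(l * ε ^ 2 / 8)))
          + m * (2 * N) * (2 * Real.exp (-(l * ε ^ 2 / 8))) := by
  rcases hs with rfl | rfl
  · obtain ⟨A, hA⟩ := exists_measurement hm hl hN hε hcond hn hP
    refine ⟨A, fun ρ hρ => le_trans (le_of_eq ?_) (hA ρ hρ)⟩
    congr 1
    ext ω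
    simp only [Set.mem_ofPred_eq, IsAccurate, one_mul, sub_le_iff_le_add']
  -- Minimising for P is maximising for 1 - P, with the estimate v reflected to 1 - v.
  · obtain ⟨A, hA⟩ := exists_measurement hm hl hN hε hcond hn (P := fun c i => 1 - P c i)
      fun c i => (hP c i).one_sub
    obtain ⟨A', hA'⟩ := A.exists_map fun ω => (ω.1, 1 - ω.2)
    refine ⟨A', fun ρ hρ => le_trans (le_of_eq ?_) (hA ρ hρ)⟩
    rw [hA']
    congr 1
    ext ω
    have hn0 : 0 < n := by rw [hn]; positivity
    simp only [Set.mem_ofPred_eq, Set.mem_preimage, IsAccurate, meanValue_one_sub hn0 hρ]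
    rw [show 1 - ω.2 - meanValue ρ (P ω.1) = -(ω.2 - (1 - meanValue ρ (P ω.1))) by ring, abs_neg]
    refine not_congr (and_congr_right fun _ => forall_congr' fun c => ?_)
    constructor <;> intro h <;> linarith

/-- For ε < 1/2 one has log(2/ε) ≥ 1, so k ≥ 2 log(2/δ); with 3/4 ≤ exp(-1/4) the exponent 3k/4
suffices. -/
lemma three_quarters_pow_le {δ ε : ℝ} {T k : ℕ} (hT : 0 < T) (hε : 0 < ε) (hε' : ε < 1 / 2)
    (hδ : 0 < δ) (hδ' : δ < 1)
    (hk : 2 * (Real.log (2 / δ) * Real.log (2 / ε)) ≤ (k : ℝ)) :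
    (3 / 4 : ℝ) ^ (3 * T * k) ≤ δ / 2 := by
  have hlδ : 0 < Real.log (2 / δ) := Real.log_pos (by rw [lt_div_iff₀ hδ]; linarith)
  have hlε : 1 ≤ Real.log (2 / ε) := by
    rw [Real.le_log_iff_exp_le (by positivity)]
    have : 4 ≤ 2 / ε := by rw [le_div_iff₀ hε]; linarith
    linarith [Real.exp_one_lt_d9]
  have hk' : 2 * Real.log (2 / δ) ≤ k := by nlinarith
  have h1 : (3 / 4 : ℝ) ≤ Real.exp (-(1 / 4)) := by
    have := Real.add_one_le_exp (-(1 / 4) : ℝ)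
    linarith
  calc (3 / 4 : ℝ) ^ (3 * T * k) ≤ (3 / 4 : ℝ) ^ (3 * k) := by
        refine pow_le_pow_of_le_one (by norm_num) (by norm_num) ?_
        nlinarith
    _ ≤ Real.exp (-(1 / 4)) ^ (3 * k) := pow_le_pow_left₀ (by norm_num) h1 _
    _ = Real.exp (-(3 * k / 4)) := by rw [← Real.exp_nat_mul]; push_cast; ring_nf
    _ ≤ Real.exp (-Real.log (2 / δ)) := Real.exp_le_exp.2 (by linarith)
    _ = δ / 2 := by rw [Real.exp_neg, Real.exp_log (by positivity), inv_div]

theorem exists_accurate_measurement_of_scale {d m l T k : ℕ} (hm : 0 < m) (hl : 0 < l) (hT : 0 < T)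
    (hk : 0 < k) {s : ℝ} (hs : s = 1 ∨ s = -1) {ε δ : ℝ} (hε : 0 < ε) (hδ : 0 < δ) (hδ' : δ < 1)
    (hkδ : 2 * (Real.log (2 / δ) * Real.log (2 / ε)) ≤ (k : ℝ))
    (hcond : (Real.log m + 5) ^ 2 ≤ 1 / 1600 * (l : ℝ) * ε ^ 2)
    {P : Fin m → Fin (6 * T * k * l) → Op d} (hP : ∀ c i, IsStarProjection (P c i)) :
    ∃ A : FinitePOVM d (6 * T * k * l) (Fin m × ℝ),
      ∀ ρ : Fin (6 * T * k * l) → Op d, (∀ i, IsDensity (ρ i)) →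
        A.prob (productState ρ) {ω | ¬ IsAccurate s ε ρ P ω}
          ≤ δ / 2 + 18 * T * k * m * Real.exp (-(l * ε ^ 2 / 8)) := by
  rcases lt_or_ge ε (1 / 2) with hε' | hε'
  -- With N = 3Tk the two union bounds have total factor 6Tk + 12Tkm ≤ 18Tkm.
  · obtain ⟨A, hA⟩ := exists_accurate_measurement hm hl (N := 3 * T * k) (by positivity) hs hε hcond
      (show 6 * T * k * l = 2 * (3 * T * k) * l by ring) hP
    refine ⟨A, fun ρ hρ => (hA ρ hρ).trans ?_⟩
    have h1 := three_quarters_pow_le hT hε hε' hδ hδ' hkδ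
    have h2 : (1 : ℝ) ≤ m := Nat.one_le_cast.2 hm
    have h3 := Real.exp_pos (-(l * ε ^ 2 / 8))
    have h4 : 0 ≤ (T : ℝ) * k * Real.exp (-(l * ε ^ 2 / 8)) := by positivity
    push_cast
    nlinarith [mul_le_mul_of_nonneg_left h2 h4]
  -- For ε ≥ 1/2 the constant guess 1/2 is accurate, since mean values lie in [0,1].
  · obtain ⟨A, hA⟩ := FinitePOVM.exists_const d (6 * T * k * l) ((⟨0, hm⟩ : Fin m), (1 / 2 : ℝ))
    refine ⟨A, fun ρ hρ => ?_⟩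
    rw [hA]
    · positivity
    · have hμ : ∀ c, 0 ≤ meanValue ρ (P c) ∧ meanValue ρ (P c) ≤ 1 := fun c =>
        meanValue_mem_Icc hρ (hP c)
      rw [Set.mem_ofPred_eq, not_not]
      refine ⟨?_, fun c => ?_⟩
      · rw [abs_le]
        constructor <;> linarith [(hμ ⟨0, hm⟩).1, (hμ ⟨0, hm⟩).2]
      · dsimp only
        rcases hs with rfl | rfl <;> linarith [(hμ c).1, (hμ c).2]

/-! ### The learner -/

/-- An infimum in `ℕ∞` is attained, so a smallest cover exists for each `x`; it is nonempty because
the class is. -/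
lemma exists_finite_net {X : Type*} {d n : ℕ} {C : Set (X → Op d)} (hC : C.Nonempty) {r : ℝ}
    (hr : 0 ≤ r) (hfin : coveringNumber n r C ≠ ⊤) (x : Fin n → X) :
    ∃ (m : ℕ) (net : Fin m → X → Op d), 0 < m ∧ IsInternalCover x r C (Set.range net) ∧
      (m : ℕ∞) ≤ coveringNumber n r C := by
  have hself : IsInternalCover x r C C := by
    refine ⟨subset_rfl, fun f hf => ⟨f, hf, ?_⟩⟩
    simpa [seminormOneInf, opNorm] using hr
  have : Nonempty {N : Set (X → Op d) // IsInternalCover x r C N} := ⟨⟨C, hself⟩⟩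
  obtain ⟨⟨N, hN⟩, hmin⟩ := ciInf_mem
    fun N : {N : Set (X → Op d) // IsInternalCover x r C N} => (N : Set (X → Op d)).encard
  have hle : N.encard ≤ coveringNumber n r C := by
    refine le_trans (le_of_eq hmin) ?_
    exact le_iSup (fun x : Fin n → X =>
      ⨅ N : {N : Set (X → Op d) // IsInternalCover x r C N}, (N : Set (X → Op d)).encard) x
  have hNfin : N.Finite := Set.encard_ne_top_iff.1 fun h => hfin (top_le_iff.1 (h ▸ hle))
  have := hNfin.fintype
  obtain ⟨f, hf⟩ := hC
  obtain ⟨g, hg, -⟩ := hN.2 f hf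
  have : Nonempty N := ⟨⟨g, hg⟩⟩
  refine ⟨Fintype.card N, fun i => ((Fintype.equivFin N).symm i : X → Op d), Fintype.card_pos, ?_, ?_⟩
  · have : Set.range (fun i => ((Fintype.equivFin N).symm i : X → Op d)) = N := by
      rw [Set.range_comp' Subtype.val, (Fintype.equivFin N).symm.surjective.range_eq, Set.image_univ,
        Subtype.range_val]
    rwa [this]
  · rwa [Set.coe_fintypeCard]

lemma upperIntegral_le_const {α : Type*} [MeasurableSpace α] (μ : MeasureTheory.Measure α)
    [MeasureTheory.IsProbabilityMeasure μ] {f : α → ENNReal} {b : ENNReal} (h : ∀ a, f a ≤ b) :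
    upperIntegral μ f ≤ b := by
  refine (iInf_le_of_le (fun _ => b) (iInf₂_le measurable_const h)).trans ?_
  simp

/-- For an accurate outcome the estimate has the accuracy that is required of a learner. -/
lemma not_mem_errorEvent {X : Type*} {d n : ℕ} {C : Set (X → Op d)} (hn : 0 < n)
    (hproj : ∀ c ∈ C, ∀ x, IsStarProjection (c x)) {ε γ s : ℝ} (hγ : 0 < |γ|) (hγε : |γ| < ε)
    {opt : Set ℝ → ℝ} (hopt : (opt = sSup ∧ s = 1) ∨ (opt = sInf ∧ s = -1))
    (A : Learner C n (ε / 2)) {ρ : X → Op d} (hρ : ∀ x, IsDensity (ρ x)) (x : Fin n → X)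
    {ω : Fin (A.size x) × ℝ}
    (hω : IsAccurate s ε (fun i => ρ (x i)) (fun j i => A.net x j (x i)) ω) :
    ω ∉ A.errorEvent opt γ ε ρ x := by
  have hnet : ∀ j, A.net x j ∈ C := fun j => (A.net_cover x).1 ⟨j, rfl⟩
  have htilt : ∀ c ∈ C, |conceptValue γ ρ x c
      - meanValue (fun i => ρ (x i)) fun i => c (x i)| ≤ |γ| / 8 := fun c hc =>
    abs_tiltedValue_sub_meanValue_le hn (abs_pos.1 hγ) (fun i => hρ _) fun i => hproj c hc _
  obtain ⟨h1, h2⟩ := hω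
  have h1' := abs_le.1 h1
  have h3 := abs_le.1 (htilt _ (hnet ω.1))
  -- 17/8 = 3/2 (accuracy) + 1/2 (net) + 1/8 (tilt).
  have hall : ∀ v ∈ conceptValue γ ρ x '' C, s * (v - ω.2) ≤ 17 / 8 * ε := by
    rintro _ ⟨c, hc, rfl⟩
    obtain ⟨_, ⟨j, rfl⟩, hj⟩ := (A.net_cover x).2 c hc
    have h4 := abs_le.1 ((abs_meanValue_sub_le hρ x c (A.net x j)).trans hj)
    have h5 := abs_le.1 (htilt c hc)
    have h6 := h2 j
    rcases hopt with ⟨-, rfl⟩ | ⟨-, rfl⟩ <;> linarith [h4.1, h4.2, h5.1, h5.2]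
  have hmem : conceptValue γ ρ x (A.net x ω.1) ∈ conceptValue γ ρ x '' C := ⟨_, hnet ω.1, rfl⟩
  simp only [Learner.errorEvent, Set.mem_ofPred_eq, not_or, not_le]
  refine ⟨?_, ?_⟩
  · rcases hopt with ⟨rfl, rfl⟩ | ⟨rfl, rfl⟩
    · have hub : ∀ v ∈ conceptValue γ ρ x '' C, v ≤ ω.2 + 17 / 8 * ε := fun v hv => by
        linarith [hall v hv]
      have h7 := csSup_le ⟨_, hmem⟩ hub
      have h8 := le_csSup ⟨_, hub⟩ hmem
      rw [abs_lt]
      constructor <;> linarith [h3.1, h3.2, h1'.1, h1'.2]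
    · have hlb : ∀ v ∈ conceptValue γ ρ x '' C, ω.2 - 17 / 8 * ε ≤ v := fun v hv => by
        linarith [hall v hv]
      have h7 := le_csInf ⟨_, hmem⟩ hlb
      have h8 := csInf_le ⟨_, hlb⟩ hmem
      rw [abs_lt]
      constructor <;> linarith [h3.1, h3.2, h1'.1, h1'.2]
  · rw [abs_lt]
    constructor <;> linarith [h3.1, h3.2, h1'.1, h1'.2]

/-- From e^|γ| - 1 ≥ |γ| the stated exponent is at most lε²/12, below the lε²/8 achieved; the last
summand of the bound only adds to it. -/
lemma le_errorBound {X : Type*} {d : ℕ} {C : Set (X → Op d)} {ε δ γ : ℝ} (hγ : 0 < |γ|)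
    {T k l m : ℕ} (hm : m ≤ (coveringNumber (6 * T * k * l) (ε / 2) C).toNat) :
    δ / 2 + 18 * T * k * m * Real.exp (-(l * ε ^ 2 / 8)) ≤ errorBound 18 ε δ γ C T k l := by
  have h1 : (m : ℝ) ≤ ((coveringNumber (6 * T * k * l) (ε / 2) C).toNat : ℝ) := Nat.cast_le.2 hm
  have h2 : |γ| + 1 ≤ Real.exp |γ| := Real.add_one_le_exp _
  have h3 : (l : ℝ) * |γ| * ε ^ 2 / (12 * (Real.exp |γ| - 1)) ≤ l * ε ^ 2 / 8 := by
    rw [div_le_div_iff₀ (by linarith) (by norm_num)]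
    have : 0 ≤ (l : ℝ) * ε ^ 2 := by positivity
    nlinarith [mul_le_mul_of_nonneg_left h2 this, mul_nonneg this hγ.le]
  rw [errorBound]
  have h4 : 0 ≤ 8 * ((coveringNumber (12 * T * k * l) (ε / 128) C).toNat : ℝ)
      * Real.exp (-(6 * (T : ℝ) * (k : ℝ) * (l : ℝ) * ε ^ 2 / (512 * |Real.exp γ - 1|))) := by
    positivity
  have h5 : 18 * T * k * m * Real.exp (-(l * ε ^ 2 / 8))
      ≤ 18 * (T : ℝ) * (k : ℝ) * ((coveringNumber (6 * T * k * l) (ε / 2) C).toNat : ℝ)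
        * Real.exp (-((l : ℝ) * |γ| * ε ^ 2 / (12 * (Real.exp |γ| - 1)))) := by
    gcongr
  linarith

theorem exists_learner {X : Type*} [MeasurableSpace X] {d : ℕ} {C : Set (X → Op d)}
    (hC : C.Nonempty) (hproj : ∀ c ∈ C, ∀ x, IsStarProjection (c x)) {ε δ γ : ℝ} (hε : 0 < ε)
    (hδ : 0 < δ) (hδ' : δ < 1) (hγ : 0 < |γ|) (hγε : |γ| < ε) {opt : Set ℝ → ℝ}
    (hopt : opt = sSup ∨ opt = sInf) {T k l : ℕ} (hT : 0 < T) (hk : 0 < k) (hl : 0 < l)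
    (hkδ : 2 * (Real.log (2 / δ) * Real.log (2 / ε)) ≤ (k : ℝ))
    (hfin : coveringNumber (6 * T * k * l) (ε / 2) C ≠ ⊤)
    (hcond : BlockCondition (1 / 1600) 5 ε C T k l) :
    ∃ A : Learner C (6 * T * k * l) (ε / 2),
      ∀ (D : MeasureTheory.Measure X) [MeasureTheory.IsProbabilityMeasure D] (ρ : X → Op d),
        (∀ x, IsDensity (ρ x)) →
        A.errorProb opt γ ε D ρ ≤ ENNReal.ofReal (errorBound 18 ε δ γ C T k l) := by
  classical
  obtain ⟨s, hs⟩ : ∃ s : ℝ, (opt = sSup ∧ s = 1) ∨ (opt = sInf ∧ s = -1) := by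
    rcases hopt with h | h
    · exact ⟨1, Or.inl ⟨h, rfl⟩⟩
    · exact ⟨-1, Or.inr ⟨h, rfl⟩⟩
  have hs1 : s = 1 ∨ s = -1 := hs.imp And.right And.right
  choose size net hpos hcover hsize using exists_finite_net hC (by positivity : 0 ≤ ε / 2) hfin
  -- `spec` quantifies over all states, so the measurement can be selected from the projectors
  -- alone.
  let spec : (m : ℕ) → (Fin m → Fin (6 * T * k * l) → Op d) →
      FinitePOVM d (6 * T * k * l) (Fin m × ℝ) → Prop := fun m P A =>
    ∀ ρ : Fin (6 * T * k * l) → Op d, (∀ i, IsDensity (ρ i)) →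
      A.prob (productState ρ) {ω | ¬ IsAccurate s ε ρ P ω}
        ≤ δ / 2 + 18 * T * k * m * Real.exp (-(l * ε ^ 2 / 8))
  let A : Learner C (6 * T * k * l) (ε / 2) :=
    { size := size
      size_pos := hpos
      net := net
      net_cover := hcover
      size_le := hsize
      select := fun m hm P =>
        if h : ∃ A, spec m P A then h.choose
        else (FinitePOVM.exists_const d _ ((⟨0, hm⟩ : Fin m), (0 : ℝ))).choose }
  refine ⟨A, fun D _ ρ hρ => ?_⟩
  -- The bound holds for every `x`, so a constant dominates the integrand and no measurability is
  -- needed.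
  refine upperIntegral_le_const _ fun x => ENNReal.ofReal_le_ofReal ?_
  have hle : size x ≤ (coveringNumber (6 * T * k * l) (ε / 2) C).toNat := by
    rw [← ENat.natCast_le_natCast, ENat.natCast_toNat hfin]
    exact hsize x
  have hm : 0 < size x := hpos x
  have hcond' : (Real.log (size x) + 5) ^ 2 ≤ 1 / 1600 * (l : ℝ) * ε ^ 2 := by
    refine le_trans (pow_le_pow_left₀ ?_ ?_ 2) hcond
    · have := Real.log_natCast_nonneg (size x)
      linarith
    · have := Real.log_le_log (Nat.cast_pos.2 hm) (Nat.cast_le (α := ℝ).2 hle)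
      linarith
  have hex : ∃ B, spec (size x) (fun j i => net x j (x i)) B :=
    exists_accurate_measurement_of_scale hm hl hT hk hs1 hε hδ hδ' hkδ hcond'
      fun j i => hproj _ ((hcover x).1 ⟨j, rfl⟩) _
  have hmeas : spec (size x) (fun j i => net x j (x i)) (A.measurement x) := by
    have : A.measurement x = hex.choose := dif_pos hex
    rw [this]
    exact hex.choose_spec
  refine (FinitePOVM.prob_mono _ (tensorFamily_posSemidef fun i => (hρ (x i)).1) ?_).trans
    ((hmeas (fun i => ρ (x i)) fun i => hρ _).trans (le_errorBound hγ hle))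
  intro ω hω hacc
  exact not_mem_errorEvent (by positivity) hproj hγ hγε hs A hρ x hacc hω

/-! ### Large block lengths -/

section Limits

open Filter

variable {X : Type*} {d : ℕ} {C : Set (X → Op d)}

lemma SlowCovering.eventually_log_sq_le (hC : SlowCovering C) {r : ℝ} (hr : 0 < r) {M : ℕ}
    (hM : 0 < M) {a : ℝ} (ha : 0 < a) :
    ∀ᶠ l : ℕ in atTop, Real.log ((coveringNumber (M * l) r C).toNat : ℝ) ^ 2 ≤ a * l := by
  have hM' : (0 : ℝ) < M := Nat.cast_pos.2 hM
  have h := (hC r hr).2.comp (tendsto_id.const_mul_atTop' hM)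
  filter_upwards [h.eventually_lt_const (by positivity : 0 < a / M), eventually_gt_atTop 0]
    with l hl hl0
  have hl0' : (0 : ℝ) < l := Nat.cast_pos.2 hl0
  simp only [Function.comp_apply, id_eq, Nat.cast_mul] at hl
  rw [div_lt_div_iff₀ (by positivity) hM'] at hl
  have : Real.log ((coveringNumber (M * l) r C).toNat : ℝ) ^ 2 * M ≤ a * l * M := by linarith
  exact le_of_mul_le_mul_right this hM'

/-- With L = log Γ, eventually L ≤ 1 + L² ≤ 1 + al/2, so Γ grows at most like e^(al/2). -/
lemma SlowCovering.tendsto_mul_exp (hC : SlowCovering C) {r : ℝ} (hr : 0 < r) {M : ℕ}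
    (hM : 0 < M) {a : ℝ} (ha : 0 < a) :
    Tendsto (fun l : ℕ => ((coveringNumber (M * l) r C).toNat : ℝ) * Real.exp (-(a * l)))
      atTop (nhds 0) := by
  have hlim : Tendsto (fun l : ℕ => Real.exp 1 * Real.exp (-(a / 2 * l))) atTop (nhds 0) := by
    have h1 : Tendsto (fun l : ℕ => a / 2 * (l : ℝ)) atTop atTop :=
      tendsto_natCast_atTop_atTop.const_mul_atTop (by positivity)
    simpa using (Real.tendsto_exp_neg_atTop_nhds_zero.comp h1).const_mul (Real.exp 1)
  refine squeeze_zero' (Eventually.of_forall fun l => by positivity) ?_ hlim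
  filter_upwards [hC.eventually_log_sq_le hr hM (by positivity : 0 < a / 2)] with l hl
  set L := Real.log ((coveringNumber (M * l) r C).toNat : ℝ) with hL
  have h1 : ((coveringNumber (M * l) r C).toNat : ℝ) ≤ Real.exp L := Real.le_exp_log _
  have h2 : L ≤ 1 + a / 2 * l := by nlinarith [sq_nonneg (L - 1)]
  calc _ ≤ Real.exp (1 + a / 2 * l) * Real.exp (-(a * l)) := by gcongr; exact h1.trans (by gcongr)
    _ = _ := by rw [← Real.exp_add, ← Real.exp_add]; ring_nf

lemma SlowCovering.eventually_blockCondition (hC : SlowCovering C) {C₁ C₂ ε : ℝ} (hC₁ : 0 < C₁)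
    (hε : 0 < ε) {T k : ℕ} (hT : 0 < T) (hk : 0 < k) :
    ∀ᶠ l : ℕ in atTop, BlockCondition C₁ C₂ ε C T k l := by
  have ha : 0 < C₁ * ε ^ 2 / 4 := by positivity
  have h2 : ∀ᶠ l : ℕ in atTop, 2 * C₂ ^ 2 / (C₁ * ε ^ 2 / 2) ≤ (l : ℝ) :=
    tendsto_natCast_atTop_atTop.eventually_ge_atTop _
  filter_upwards [hC.eventually_log_sq_le (by positivity : 0 < ε / 2)
    (by positivity : 0 < 6 * T * k) ha, h2] with l hl hl2
  rw [div_le_iff₀ (by positivity)] at hl2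
  rw [BlockCondition]
  -- (L + C₂)² ≤ 2L² + 2C₂², and each summand is at most half of C₁lε².
  nlinarith [sq_nonneg (Real.log ((coveringNumber (6 * T * k * l) (ε / 2) C).toNat : ℝ) - C₂)]

lemma SlowCovering.eventually_errorBound_le (hC : SlowCovering C) {C₃ ε δ γ : ℝ}
    (hε : 0 < ε) (hδ : 0 < δ) (hγ : 0 < |γ|) {T k : ℕ} (hT : 0 < T) (hk : 0 < k) :
    ∀ᶠ l : ℕ in atTop, errorBound C₃ ε δ γ C T k l ≤ δ := by
  have hγ1 : 0 < Real.exp |γ| - 1 := by linarith [Real.add_one_le_exp |γ|]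
  have hγ2 : 0 < |Real.exp γ - 1| := by
    rw [abs_pos, sub_ne_zero, Ne, Real.exp_eq_one_iff]
    exact abs_pos.1 hγ
  have hT' : (0 : ℝ) < T := Nat.cast_pos.2 hT
  have hk' : (0 : ℝ) < k := Nat.cast_pos.2 hk
  have h1 := (hC.tendsto_mul_exp (by positivity : 0 < ε / 2) (by positivity : 0 < 6 * T * k)
    (by positivity : 0 < |γ| * ε ^ 2 / (12 * (Real.exp |γ| - 1)))).const_mul (C₃ * T * k)
  have h2 := (hC.tendsto_mul_exp (by positivity : 0 < ε / 128) (by positivity : 0 < 12 * T * k)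
    (by positivity : 0 < 6 * (T : ℝ) * k * ε ^ 2 / (512 * |Real.exp γ - 1|))).const_mul 8
  have h := h1.add h2
  rw [mul_zero, mul_zero, add_zero] at h
  filter_upwards [h.eventually_lt_const (half_pos hδ)] with l hl
  rw [errorBound]
  have e1 : (l : ℝ) * |γ| * ε ^ 2 / (12 * (Real.exp |γ| - 1))
      = |γ| * ε ^ 2 / (12 * (Real.exp |γ| - 1)) * l := by ring
  have e2 : 6 * (T : ℝ) * k * l * ε ^ 2 / (512 * |Real.exp γ - 1|)
      = 6 * (T : ℝ) * k * ε ^ 2 / (512 * |Real.exp γ - 1|) * l := by ring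
  rw [e1, e2]
  linarith

end Limits

end QTERM

theorem theorem4 :
    ∃ C₁ C₂ C₃ K : ℝ, 0 < C₁ ∧ 0 < C₂ ∧ 0 < C₃ ∧ 0 < K ∧
      ∀ (X : Type*) [MeasurableSpace X] (d : ℕ) (C : Set (X → QTERM.Op d)),
        C.Nonempty →
        (∀ c ∈ C, ∀ x, IsStarProjection (c x)) →
        QTERM.SlowCovering C →
        ∀ ε δ γ : ℝ, 0 < ε → 0 < δ → δ < 1 → 0 < |γ| → |γ| < ε →
        ∀ opt : Set ℝ → ℝ, (opt = sSup ∨ opt = sInf) →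
        ∀ T k : ℕ, 0 < T → 0 < k →
          K * Real.log (2 / ε) ≤ (T : ℝ) →
          K * (Real.log (2 / δ) * Real.log (2 / ε)) ≤ (k : ℝ) →
          (∀ l : ℕ, 0 < l → QTERM.BlockCondition C₁ C₂ ε C T k l →
            ∃ A : QTERM.Learner C (6 * T * k * l) (ε / 2),
              ∀ (D : MeasureTheory.Measure X) [MeasureTheory.IsProbabilityMeasure D]
                (ρ : X → QTERM.Op d), (∀ x, QTERM.IsDensity (ρ x)) →
                A.errorProb opt γ ε D ρ
                  ≤ ENNReal.ofReal (QTERM.errorBound C₃ ε δ γ C T k l)) ∧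
          (∀ᶠ l : ℕ in Filter.atTop,
            QTERM.BlockCondition C₁ C₂ ε C T k l ∧
              QTERM.errorBound C₃ ε δ γ C T k l ≤ δ) := by
  -- 1/1600 and 5 come from `testScale_exp_le`, 18 from the union bounds over blocks, 2 from
  -- `three_quarters_pow_le`.
  refine ⟨1 / 1600, 5, 18, 2, by norm_num, by norm_num, by norm_num, by norm_num, ?_⟩
  intro X _ d C hC hproj hslow ε δ γ hε hδ hδ' hγ hγε opt hopt T k hT hk _ hkδ
  refine ⟨fun l hl hcond => ?_, ?_⟩
  · exact QTERM.exists_learner hC hproj hε hδ hδ' hγ hγε hopt hT hk hl hkδ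
      ((hslow (ε / 2) (by positivity)).1 _) hcond
  · exact (hslow.eventually_blockCondition (by norm_num) hε hT hk).and
      (hslow.eventually_errorBound_le hε hδ hγ hT hk)
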